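/- Let $F=(F_1,\dots,F_m):\mathbb{R}^n\to\mathbb{R}^m$ be twice continuously differentiable. Write $\mathcal{D}(x,d)=\max_{j}\nabla F_j(x)^\top d$, and call $x$ Pareto critical if there is no $d\in\mathbb{R}^n$ with $\nabla F_j(x)^\top d<0$ for all $j=1,\dots,m$. Let $\rho\in(0,1/2)$, $\sigma\in(\rho,1)$, $0<\underline{\vartheta}\le\bar\vartheta$, $x^0\in\mathbb{R}^n$, and symmetric positive definite matrices $B_1^0,\dots,B_m^0\in\mathbb{R}^{n\times n}$ be given. Let $\{x^k\}_{k\ge 0}$ be an infinite sequence generated by the following BFGS-type algorithm; that is, no $x^k$ is Pareto critical and, for every $k\ge 0$ and every $j$: 1. $d^k$ is the minimizer over $d\in\mathbb{R}^n$ of $\max_{j}\{\nabla F_j(x^k)^\top d+\tfrac12 d^\top B_j^k d\}$; 2. $x^{k+1}=x^k+\alpha_k d^k$, where $\alpha_k>0$ is any step size satisfying the Wolfe conditions $F_j(x^k+\alpha_kd^k)\le F_j(x^k)+\rho\alpha_k\mathcal{D}(x^k,d^k)$ for all $j$, and $\mathcal{D}(x^k+\alpha_kd^k,d^k)\ge\sigma\mathcal{D}(x^k,d^k)$;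 3. with $s^k=x^{k+1}-x^k$, $y_j^k=\nabla F_j(x^{k+1})-\nabla F_j(x^k)$, $\eta_j^k=(y_j^k)^\top s^k/\|s^k\|^2$, some $\mu^k\in\mathbb{R}^m$ with nonnegative entries summing to $1$, and some $\vartheta_k\in(\underline{\vartheta},\bar\vartheta)$, put $$r_j^k=\max\{-\eta_j^k,0\}+\vartheta_k\Big\|\sum_{i=1}^m\mu_i^k\nabla F_i(x^k)\Big\|,\qquad \gamma_j^k=y_j^k+r_j^ks^k;$$ 4. $\displaystyle B_j^{k+1}=B_j^k-\frac{B_j^ks^k(s^k)^\top B_j^k}{(s^k)^\top B_j^ks^k}+\frac{\gamma_j^k(\gamma_j^k)^\top}{(\gamma_j^k)^\top s^k}.$ Suppose that $\{x^k\}$ converges to a local Pareto optimal point $x^*$ of $F$ (there is a neighborhood $U$ of $x^*$ containing no $x$ with $F_j(x)\le F_j(x^*)$ for all $j$ and $F(x)\ne F(x^*)$), that $\nabla^2F_j(x^*)$ is positive definite for every $j$, and that for every $j$ there are constants $\nu\in(0,1]$ and $M>0$ with $\|\nabla^2F_j(x)-\nabla^2F_j(x^*)\|\le M\|x-x^*\|^\nu$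 for all $x$ in a neighborhood of $x^*$. Suppose also that $\sum_{k\ge0}r_j^k<\infty$ for every $j$. Then, for every $j=1,\dots,m$, $$\lim_{k\to\infty}\frac{\|(B_j^k-\nabla^2F_j(x^*))d^k\|}{\|d^k\|}=0 .$$ -/

import Mathlib

open Filter Topology

noncomputable section

namespace MOBFGS

/-- The Euclidean space `ℝⁿ`. -/
abbrev Vec (n : ℕ) := EuclideanSpace ℝ (Fin n)

/-- A matrix acting on a vector of `ℝⁿ`: `A v`. -/
def act {n : ℕ} (A : Matrix (Fin n) (Fin n) ℝ) (v : Vec n) : Vec n :=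
  Matrix.toEuclideanCLM (n := Fin n) (𝕜 := ℝ) A v

/-- The spectral norm of a square matrix, i.e. the norm induced by the Euclidean norm. -/
def specNorm {n : ℕ} (A : Matrix (Fin n) (Fin n) ℝ) : ℝ :=
  ‖Matrix.toEuclideanCLM (n := Fin n) (𝕜 := ℝ) A‖

/-- The gradient `∇F_j(x)` of the `j`-th objective. -/
def grad {n m : ℕ} (F : Vec n → Vec m) (j : Fin m) (x : Vec n) : Vec n :=
  gradient (fun y => F y j) x

/-- The Hessian matrix `∇²F_j(x)`: its entry `(a, b)` is the partial derivative in direction `b`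
of the `a`-th component of `∇F_j`. -/
def hess {n m : ℕ} (F : Vec n → Vec m) (j : Fin m) (x : Vec n) : Matrix (Fin n) (Fin n) ℝ :=
  Matrix.of fun a b => (fderiv ℝ (grad F j) x (EuclideanSpace.single b 1)) a

/-- `x` is Pareto critical: the image of the Jacobian `JF(x)`, whose rows are the gradients
`∇F_j(x)`, contains no vector with all coordinates negative. -/
def IsParetoCritical {n m : ℕ} (F : Vec n → Vec m) (x : Vec n) : Prop :=
  ¬ ∃ d : Vec n, ∀ j, inner ℝ (grad F j x) d < 0

/-- `z` is a local Pareto optimal point of `F`. -/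
def IsLocalParetoOptimal {n m : ℕ} (F : Vec n → Vec m) (z : Vec n) : Prop :=
  ∃ U ∈ 𝓝 z, ¬ ∃ x ∈ U, (∀ j, F x j ≤ F z j) ∧ F x ≠ F z

/-- `𝒟(x, d) = max_j ∇F_j(x)ᵀ d`. -/
def maxSlope {n m : ℕ} (F : Vec n → Vec m) (x d : Vec n) : ℝ :=
  ⨆ j, inner ℝ (grad F j x) d

/-- The objective of the direction subproblem: `max_j ∇F_j(x)ᵀ d + ½ dᵀ B_j d`. -/
def modelValue {n m : ℕ} (F : Vec n → Vec m) (B : Fin m → Matrix (Fin n) (Fin n) ℝ)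
    (x d : Vec n) : ℝ :=
  ⨆ j, (inner ℝ (grad F j x) d + (1 / 2) * inner ℝ d (act (B j) d))

/-- The multiobjective standard Wolfe conditions for the step size `α` along `d` from `x`. -/
def IsWolfeStep {n m : ℕ} (F : Vec n → Vec m) (ρ σ : ℝ) (x d : Vec n) (α : ℝ) : Prop :=
  (∀ j, F (x + α • d) j ≤ F x j + ρ * α * maxSlope F x d) ∧
    σ * maxSlope F x d ≤ maxSlope F (x + α • d) d

/-- `y_j = ∇F_j(x') - ∇F_j(x)`, for consecutive iterates `x`, `x'`. -/
def gradDiff {n m : ℕ} (F : Vec n → Vec m) (x x' : Vec n) (j : Fin m) : Vec n :=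
  grad F j x' - grad F j x

/-- `η_j = y_jᵀ s / ‖s‖²`, with `s = x' - x`. -/
def curvature {n m : ℕ} (F : Vec n → Vec m) (x x' : Vec n) (j : Fin m) : ℝ :=
  inner ℝ (gradDiff F x x' j) (x' - x) / ‖x' - x‖ ^ 2

/-- `r_j = max {-η_j, 0} + ϑ ‖∑ i, μ_i ∇F_i(x)‖`. -/
def correction {n m : ℕ} (F : Vec n → Vec m) (ϑ : ℝ) (μ : Fin m → ℝ) (x x' : Vec n)
    (j : Fin m) : ℝ :=
  max (-curvature F x x' j) 0 + ϑ * ‖∑ i, μ i • grad F i x‖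

/-- `γ_j = y_j + r_j s`. -/
def correctedDiff {n m : ℕ} (F : Vec n → Vec m) (ϑ : ℝ) (μ : Fin m → ℝ) (x x' : Vec n)
    (j : Fin m) : Vec n :=
  gradDiff F x x' j + correction F ϑ μ x x' j • (x' - x)

/-- The BFGS formula `B - B s sᵀ B / (sᵀ B s) + γ γᵀ / (γᵀ s)`. -/
def bfgsUpdate {n : ℕ} (B : Matrix (Fin n) (Fin n) ℝ) (s γ : Vec n) :
    Matrix (Fin n) (Fin n) ℝ :=
  B - (inner ℝ s (act B s))⁻¹ • (B * Matrix.vecMulVec s s * B)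
    + (inner ℝ γ s)⁻¹ • Matrix.vecMulVec γ γ

/-- The sequences form an infinite run of the BFGS-type algorithm on `F` with parameters
`ρ, σ, ϑlo, ϑhi`: iterates `x k`, directions `d k`, step sizes `α k`, matrices `B k j`, and the
free choices `ϑ k` and `μ k`. The run is infinite, so the stopping test never succeeds.
Any step size that satisfies the Wolfe conditions may be taken. -/
structure IsRun {n m : ℕ} (F : Vec n → Vec m) (ρ σ ϑlo ϑhi : ℝ)
    (x d : ℕ → Vec n) (α ϑ : ℕ → ℝ) (μ : ℕ → Fin m → ℝ)
    (B : ℕ → Fin m → Matrix (Fin n) (Fin n) ℝ) : Prop where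
  rho_mem : ρ ∈ Set.Ioo (0 : ℝ) (1 / 2)
  sigma_mem : σ ∈ Set.Ioo ρ 1
  lo_pos : 0 < ϑlo
  lo_le_hi : ϑlo ≤ ϑhi
  init_posDef : ∀ j, (B 0 j).PosDef
  direction : ∀ k, IsMinOn (modelValue F (B k) (x k)) Set.univ (d k)
  not_critical : ∀ k, ¬ IsParetoCritical F (x k)
  step_pos : ∀ k, 0 < α k
  wolfe : ∀ k, IsWolfeStep F ρ σ (x k) (d k) (α k)
  next_iterate : ∀ k, x (k + 1) = x k + α k • d k
  theta_mem : ∀ k, ϑ k ∈ Set.Ioo ϑlo ϑhi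
  mu_mem : ∀ k, μ k ∈ stdSimplex ℝ (Fin m)
  update : ∀ k j, B (k + 1) j =
    bfgsUpdate (B k j) (x (k + 1) - x k) (correctedDiff F (ϑ k) (μ k) (x k) (x (k + 1)) j)

/-- The Hessian of `F_j` is Hölder continuous at the point `z`. -/
def HessHolderAt {n m : ℕ} (F : Vec n → Vec m) (j : Fin m) (z : Vec n) : Prop :=
  ∃ ν ∈ Set.Ioc (0 : ℝ) 1, ∃ M > (0 : ℝ),
    ∀ᶠ x in 𝓝 z, specNorm (hess F j x - hess F j z) ≤ M * ‖x - z‖ ^ ν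

end MOBFGS

end

/-!
The proof compares each `B_j^k` with the limit Hessian `G = ∇²F_j(x*)` through the potential
`ψ(B) = tr(G⁻¹B) - log det B`, which is bounded below on positive definite matrices
(`potential_lower_bound`). The trace and determinant of a BFGS update are explicit
(`trace_inv_mul_bfgsCoord`, `det_bfgsCoord`), and they give
`ψ(B^{k+1}) ≤ ψ(B^k) - t_k + C ε_k`, where `ε_k` is the relative error in `γ^k ≈ G s^k` and the
loss `t_k = ‖Bs‖²_{G⁻¹} / sᵀBs - 1 - log (sᵀBs / sᵀGs)` is nonnegative
(`exists_potential_bfgsUpdate_le`). If `t_k → 0`, then `B^k` and `G` agree asymptotically along the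
steps, which is the claim (`tendsto_of_potentialLoss_tendsto_zero`). So it suffices that
`∑ ε_k < ∞`. By the Hölder condition `ε_k` is at most
`M (‖x^k - x*‖^ν + ‖x^{k+1} - x*‖^ν) + r_j^k`, and it remains to show that `x^k` converges to `x*`
R-linearly (`IsRun.summable_norm_sub_rpow`).

The same potential yields linear convergence, now using only `ε_k → 0`. Where the losses of all
objectives are at most `1`, every `B_j^k` is bounded above and below along `d^k`
(`exists_bounds_of_potentialLoss_le_one`). The Wolfe conditions, the stationarity of the direction
subproblem and strong convexity near `x*` then decrease every `F_j` by a multiple of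
`‖x^k - x*‖²` (`wolfe_step_decrease`). By Gordan's alternative some convex combination of the
objectives is stationary at `x*`; its excess `Φ_k` over the value at `x*` is comparable to
`‖x^k - x*‖²`. Thus `Φ` contracts in every good step and never increases, while steps with a large
loss are paid for by the potential: `Φ exp (κ ∑_j ψ_j)` decreases geometrically for a suitable
`κ > 0` (`exists_geometric_bound`).
-/

namespace MOBFGS

/-! ### The BFGS update of a positive definite matrix -/

section Matrices

open Matrix

variable {ι : Type*} [Fintype ι]

lemma dotProduct_mulVec_comm_of_isHermitian {A : Matrix ι ι ℝ} (hA : A.IsHermitian) (v w : ι → ℝ) :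
    v ⬝ᵥ A *ᵥ w = w ⬝ᵥ A *ᵥ v := by
  have h : Aᵀ = A := by simpa [IsHermitian, conjTranspose_eq_transpose_of_trivial] using hA
  rw [dotProduct_mulVec, ← mulVec_transpose, h, dotProduct_comm]

lemma posDef_quadratic_pos {A : Matrix ι ι ℝ} (hA : A.PosDef) {v : ι → ℝ} (hv : v ≠ 0) :
    0 < v ⬝ᵥ A *ᵥ v := by
  simpa using hA.dotProduct_mulVec_pos hv

lemma posDef_quadratic_nonneg {A : Matrix ι ι ℝ} (hA : A.PosDef) (v : ι → ℝ) :
    0 ≤ v ⬝ᵥ A *ᵥ v := by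
  simpa using hA.posSemidef.dotProduct_mulVec_nonneg v

lemma quadratic_sub_smul {A : Matrix ι ι ℝ} (hA : A.IsHermitian) (v w : ι → ℝ) (t : ℝ) :
    (v - t • w) ⬝ᵥ A *ᵥ (v - t • w) =
      v ⬝ᵥ A *ᵥ v - 2 * t * (w ⬝ᵥ A *ᵥ v) + t ^ 2 * (w ⬝ᵥ A *ᵥ w) := by
  simp only [mulVec_sub, mulVec_smul, dotProduct_sub, sub_dotProduct, dotProduct_smul,
    smul_dotProduct, smul_eq_mul, dotProduct_mulVec_comm_of_isHermitian hA v w]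
  ring

/-- Cauchy–Schwarz for the inner product of a positive definite matrix. -/
lemma posDef_cauchySchwarz {A : Matrix ι ι ℝ} (hA : A.PosDef) (v w : ι → ℝ) :
    (w ⬝ᵥ A *ᵥ v) ^ 2 ≤ (w ⬝ᵥ A *ᵥ w) * (v ⬝ᵥ A *ᵥ v) := by
  rcases eq_or_ne w 0 with rfl | hw
  · simp
  have hq := posDef_quadratic_pos hA hw
  have h := posDef_quadratic_nonneg hA (v - ((w ⬝ᵥ A *ᵥ v) / (w ⬝ᵥ A *ᵥ w)) • w)
  rw [quadratic_sub_smul hA.isHermitian] at h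
  have h2 := mul_nonneg hq.le h
  have : (w ⬝ᵥ A *ᵥ w) * (v ⬝ᵥ A *ᵥ v - 2 * ((w ⬝ᵥ A *ᵥ v) / (w ⬝ᵥ A *ᵥ w)) * (w ⬝ᵥ A *ᵥ v) +
      ((w ⬝ᵥ A *ᵥ v) / (w ⬝ᵥ A *ᵥ w)) ^ 2 * (w ⬝ᵥ A *ᵥ w)) =
      (w ⬝ᵥ A *ᵥ w) * (v ⬝ᵥ A *ᵥ v) - (w ⬝ᵥ A *ᵥ v) ^ 2 := by
    field_simp; ring
  linarith

/-- The BFGS formula for coordinate vectors. -/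
noncomputable def bfgsCoord (B : Matrix ι ι ℝ) (s γ : ι → ℝ) : Matrix ι ι ℝ :=
  B - (s ⬝ᵥ B *ᵥ s)⁻¹ • (B * vecMulVec s s * B) + (γ ⬝ᵥ s)⁻¹ • vecMulVec γ γ

lemma mul_vecMulVec_mul {B : Matrix ι ι ℝ} (hB : B.IsHermitian) (s : ι → ℝ) :
    B * vecMulVec s s * B = vecMulVec (B *ᵥ s) (B *ᵥ s) := by
  have h : Bᵀ = B := by simpa [IsHermitian, conjTranspose_eq_transpose_of_trivial] using hB
  rw [mul_vecMulVec, vecMulVec_mul, ← mulVec_transpose, h]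

/-- The BFGS formula preserves positive definiteness under the curvature condition. -/
lemma bfgsCoord_posDef {B : Matrix ι ι ℝ} (hB : B.PosDef) {s γ : ι → ℝ} (hγ : 0 < γ ⬝ᵥ s) :
    (bfgsCoord B s γ).PosDef := by
  have hs : s ≠ 0 := by rintro rfl; simp at hγ
  have hq := posDef_quadratic_pos hB hs
  rw [bfgsCoord, mul_vecMulVec_mul hB.isHermitian]
  refine PosDef.of_dotProduct_mulVec_pos ?_ fun {v} hv ↦ ?_
  · have hsm : ∀ (c : ℝ) (w : ι → ℝ), (c • vecMulVec w w).IsHermitian := fun c w ↦ by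
      ext i j; simp [vecMulVec_apply, mul_comm]
    exact (hB.isHermitian.sub (hsm _ _)).add (hsm _ _)
  -- `z` is the component of `v` that is `B`-orthogonal to `s`
  set t := (s ⬝ᵥ B *ᵥ v) / (s ⬝ᵥ B *ᵥ s) with ht
  set z := v - t • s with hz
  have hzq := quadratic_sub_smul hB.isHermitian v s t
  have key : star v ⬝ᵥ (B - (s ⬝ᵥ B *ᵥ s)⁻¹ • vecMulVec (B *ᵥ s) (B *ᵥ s)
      + (γ ⬝ᵥ s)⁻¹ • vecMulVec γ γ) *ᵥ v = z ⬝ᵥ B *ᵥ z + (γ ⬝ᵥ s)⁻¹ * (γ ⬝ᵥ v) ^ 2 := by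
    rw [hz, hzq]
    simp only [star_trivial, add_mulVec, sub_mulVec, smul_mulVec, vecMulVec_mulVec,
      dotProduct_add, dotProduct_sub, dotProduct_smul, smul_eq_mul, op_smul_eq_smul]
    rw [dotProduct_comm (B *ᵥ s) v, dotProduct_comm v γ,
      dotProduct_mulVec_comm_of_isHermitian hB.isHermitian v s, ht]
    field_simp
    ring
  rw [key]
  by_cases h0 : z = 0
  · have hv' : v = t • s := by rw [hz] at h0; exact sub_eq_zero.mp h0
    have ht0 : t ≠ 0 := by
      intro h; rw [h, zero_smul] at hv'; exact hv hv'
    have : γ ⬝ᵥ v = t * (γ ⬝ᵥ s) := by rw [hv']; simp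
    rw [h0, this]
    have : 0 < (γ ⬝ᵥ s)⁻¹ * (t * γ ⬝ᵥ s) ^ 2 := by positivity
    simpa using this
  · have := posDef_quadratic_pos hB h0
    positivity

variable [DecidableEq ι]

lemma inv_mulVec_mulVec {B : Matrix ι ι ℝ} (hB : B.PosDef) (v : ι → ℝ) :
    B⁻¹ *ᵥ (B *ᵥ v) = v := by
  rw [mulVec_mulVec, nonsing_inv_mul _ ((isUnit_iff_isUnit_det B).mp hB.isUnit), one_mulVec]

lemma mulVec_inv_mulVec {B : Matrix ι ι ℝ} (hB : B.PosDef) (v : ι → ℝ) :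
    B *ᵥ (B⁻¹ *ᵥ v) = v := by
  rw [mulVec_mulVec, mul_nonsing_inv _ ((isUnit_iff_isUnit_det B).mp hB.isUnit), one_mulVec]

/-- The determinant of the BFGS update. After factoring out `B`, the update is a rank-two
perturbation of the identity, so its determinant is that of a `2 × 2` matrix. -/
lemma det_bfgsCoord {B : Matrix ι ι ℝ} (hB : B.PosDef) {s γ : ι → ℝ} (hγ : 0 < γ ⬝ᵥ s) :
    (bfgsCoord B s γ).det = B.det * ((γ ⬝ᵥ s) / (s ⬝ᵥ B *ᵥ s)) := by
  have hs : s ≠ 0 := by rintro rfl; simp at hγ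
  have hq := posDef_quadratic_pos hB hs
  set q := s ⬝ᵥ B *ᵥ s with hqdef
  set c := γ ⬝ᵥ s with hc
  let U : Matrix ι (Fin 2) ℝ := of fun i a ↦ ![s i, (B⁻¹ *ᵥ γ) i] a
  let V : Matrix (Fin 2) ι ℝ := of ![-(q⁻¹ • (B *ᵥ s)), c⁻¹ • γ]
  have hfac : bfgsCoord B s γ = B * (1 + U * V) := by
    have hUV : U * V = -(q⁻¹ • vecMulVec s (B *ᵥ s)) + c⁻¹ • vecMulVec (B⁻¹ *ᵥ γ) γ := by
      ext i j
      simp [U, V, Matrix.mul_apply, Fin.sum_univ_two, vecMulVec_apply]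
      ring
    rw [hUV, mul_add, mul_add, mul_one, mul_neg, Matrix.mul_smul, Matrix.mul_smul, mul_vecMulVec,
      mul_vecMulVec, mulVec_inv_mulVec hB, bfgsCoord, mul_vecMulVec_mul hB.isHermitian,
      ← hqdef, ← hc]
    abel
  have h00 : (V * U) 0 0 = -1 := by
    have : (V * U) 0 0 = -(q⁻¹ * ((B *ᵥ s) ⬝ᵥ s)) := by
      simp [U, V, Matrix.mul_apply, dotProduct, Finset.mul_sum, mul_assoc]
    rw [this, dotProduct_comm, ← hqdef]
    field_simp
  have h01 : (V * U) 0 1 = -(c / q) := by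
    have : (V * U) 0 1 = -(q⁻¹ * ((B *ᵥ s) ⬝ᵥ (B⁻¹ *ᵥ γ))) := by
      simp [U, V, Matrix.mul_apply, dotProduct, Finset.mul_sum, mul_assoc]
    rw [this, dotProduct_mulVec_comm_of_isHermitian hB.inv.isHermitian, inv_mulVec_mulVec hB,
      ← hc]
    field_simp
  have h10 : (V * U) 1 0 = 1 := by
    have : (V * U) 1 0 = c⁻¹ * (γ ⬝ᵥ s) := by
      simp [U, V, Matrix.mul_apply, dotProduct, Finset.mul_sum, mul_assoc]
    rw [this, ← hc]
    field_simp
  rw [hfac, det_mul, det_one_add_mul_comm, det_fin_two]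
  simp only [Matrix.add_apply, h00, h01, h10]
  simp

lemma trace_inv_mul_bfgsCoord {G B : Matrix ι ι ℝ} (hB : B.PosDef) (s γ : ι → ℝ) :
    (G⁻¹ * bfgsCoord B s γ).trace = (G⁻¹ * B).trace
      - ((B *ᵥ s) ⬝ᵥ G⁻¹ *ᵥ (B *ᵥ s)) / (s ⬝ᵥ B *ᵥ s) + (γ ⬝ᵥ G⁻¹ *ᵥ γ) / (γ ⬝ᵥ s) := by
  rw [bfgsCoord, mul_vecMulVec_mul hB.isHermitian, mul_add, mul_sub, Matrix.mul_smul,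
    Matrix.mul_smul, mul_vecMulVec, mul_vecMulVec, trace_add, trace_sub, trace_smul, trace_smul,
    trace_vecMulVec, trace_vecMulVec, dotProduct_comm (G⁻¹ *ᵥ (B *ᵥ s)),
    dotProduct_comm (G⁻¹ *ᵥ γ)]
  simp only [smul_eq_mul]
  ring

/-- The potential `tr(G⁻¹B) - log det B`. Among positive definite `B` it is smallest at `B = G`. -/
noncomputable def potential (G B : Matrix ι ι ℝ) : ℝ := (G⁻¹ * B).trace - Real.log B.det

open scoped MatrixOrder Matrix.Norms.L2Operator in
lemma _root_.Matrix.PosDef.exists_isUnit_eq_star_mul_self {A : Matrix ι ι ℝ} (hA : A.PosDef) :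
    ∃ S : Matrix ι ι ℝ, IsUnit S ∧ A = star S * S :=
  CStarAlgebra.isStrictlyPositive_iff_eq_star_mul_self.mp (isStrictlyPositive_iff_posDef.mpr hA)

/-- The potential is bounded below: after the congruence that turns `G` into the identity, it
is `∑ (λ - log λ)` over the eigenvalues `λ > 0`, up to the constant `log det G`. -/
lemma potential_lower_bound {G B : Matrix ι ι ℝ} (hG : G.PosDef) (hB : B.PosDef) :
    -Real.log G.det ≤ potential G B := by
  obtain ⟨S, hS, hGS⟩ := hG.inv.exists_isUnit_eq_star_mul_self
  have hM : (S * B * star S).PosDef := (IsUnit.posDef_star_right_conjugate_iff hS).mpr hB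
  have htr : (G⁻¹ * B).trace = (S * B * star S).trace := by
    rw [hGS, mul_assoc, trace_mul_comm]
  have hdS : S.det ^ 2 = (G.det)⁻¹ := by
    have := congrArg det hGS
    rw [det_nonsing_inv, Ring.inverse_eq_inv', det_mul, star_eq_conjTranspose,
      det_conjTranspose, star_trivial] at this
    rw [this]; ring
  have hdet : (S * B * star S).det = (G.det)⁻¹ * B.det := by
    rw [det_mul, det_mul, star_eq_conjTranspose, det_conjTranspose, star_trivial, ← hdS]; ring
  have hlog : Real.log (S * B * star S).det = Real.log B.det - Real.log G.det := by
    rw [hdet, Real.log_mul (inv_ne_zero hG.det_pos.ne') hB.det_pos.ne', Real.log_inv]; ring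
  have hmain : Real.log (S * B * star S).det ≤ (S * B * star S).trace := by
    have h1 := hM.isHermitian.det_eq_prod_eigenvalues
    have h2 := hM.isHermitian.trace_eq_sum_eigenvalues
    simp only [RCLike.ofReal_real_eq_id, id_eq] at h1 h2
    rw [h1, h2, Real.log_prod fun i _ ↦ (hM.eigenvalues_pos i).ne']
    refine Finset.sum_le_sum fun i _ ↦ ?_
    have := Real.log_le_sub_one_of_pos (hM.eigenvalues_pos i)
    linarith
  rw [potential, htr]
  linarith

/-- The loss `‖Bs‖²_{G⁻¹} / sᵀBs - 1 - log (sᵀBs / sᵀGs)` of the potential in a BFGS step. It is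
nonnegative, and it is small only if `Bs` is close to `Gs`; see
`tendsto_of_potentialLoss_tendsto_zero`. -/
noncomputable def potentialLoss (G B : Matrix ι ι ℝ) (s : ι → ℝ) : ℝ :=
  ((B *ᵥ s) ⬝ᵥ G⁻¹ *ᵥ (B *ᵥ s)) / (s ⬝ᵥ B *ᵥ s) - 1
    - Real.log ((s ⬝ᵥ B *ᵥ s) / (s ⬝ᵥ G *ᵥ s))

lemma potential_bfgsCoord {G B : Matrix ι ι ℝ} (hG : G.PosDef) (hB : B.PosDef) {s γ : ι → ℝ}
    (hγ : 0 < γ ⬝ᵥ s) :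
    potential G (bfgsCoord B s γ) = potential G B - potentialLoss G B s
      + ((γ ⬝ᵥ G⁻¹ *ᵥ γ) / (γ ⬝ᵥ s) - 1 + Real.log ((s ⬝ᵥ G *ᵥ s) / (γ ⬝ᵥ s))) := by
  have hs : s ≠ 0 := by rintro rfl; simp at hγ
  have hq := posDef_quadratic_pos hB hs
  have hg := posDef_quadratic_pos hG hs
  rw [potential, potential, potentialLoss, trace_inv_mul_bfgsCoord hB, det_bfgsCoord hB hγ,
    Real.log_mul hB.det_pos.ne' (by positivity), Real.log_div hγ.ne' hq.ne',
    Real.log_div hq.ne' hg.ne', Real.log_div hg.ne' hγ.ne']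
  ring

/-- Cauchy–Schwarz for the inner product of `G`, applied to `G⁻¹Bs` and `s`. -/
lemma sq_quadratic_le {G B : Matrix ι ι ℝ} (hG : G.PosDef) {s : ι → ℝ} :
    (s ⬝ᵥ B *ᵥ s) ^ 2 ≤ (s ⬝ᵥ G *ᵥ s) * ((B *ᵥ s) ⬝ᵥ G⁻¹ *ᵥ (B *ᵥ s)) := by
  have h := posDef_cauchySchwarz hG (G⁻¹ *ᵥ (B *ᵥ s)) s
  rw [mulVec_inv_mulVec hG, dotProduct_comm (G⁻¹ *ᵥ (B *ᵥ s))] at h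
  exact h

lemma sub_one_sub_log_le_potentialLoss {G B : Matrix ι ι ℝ} (hG : G.PosDef) (hB : B.PosDef)
    {s : ι → ℝ} (hs : s ≠ 0) :
    (s ⬝ᵥ B *ᵥ s) / (s ⬝ᵥ G *ᵥ s) - 1 - Real.log ((s ⬝ᵥ B *ᵥ s) / (s ⬝ᵥ G *ᵥ s))
      ≤ potentialLoss G B s := by
  have hq := posDef_quadratic_pos hB hs
  have hg := posDef_quadratic_pos hG hs
  have h := sq_quadratic_le (B := B) hG (s := s)
  have : (s ⬝ᵥ B *ᵥ s) / (s ⬝ᵥ G *ᵥ s) ≤ ((B *ᵥ s) ⬝ᵥ G⁻¹ *ᵥ (B *ᵥ s)) / (s ⬝ᵥ B *ᵥ s) := by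
    rw [div_le_div_iff₀ hg hq]
    nlinarith
  rw [potentialLoss]
  linarith

lemma potentialLoss_nonneg {G B : Matrix ι ι ℝ} (hG : G.PosDef) (hB : B.PosDef)
    {s : ι → ℝ} (hs : s ≠ 0) : 0 ≤ potentialLoss G B s := by
  have hu : 0 < (s ⬝ᵥ B *ᵥ s) / (s ⬝ᵥ G *ᵥ s) :=
    div_pos (posDef_quadratic_pos hB hs) (posDef_quadratic_pos hG hs)
  have := Real.log_le_sub_one_of_pos hu
  linarith [sub_one_sub_log_le_potentialLoss hG hB hs]

/-- `‖Bs‖²_{G⁻¹} / sᵀGs` as a function of `u = sᵀBs / sᵀGs` and of the loss. -/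
lemma dual_norm_eq_of_potentialLoss {G B : Matrix ι ι ℝ} (hG : G.PosDef) (hB : B.PosDef)
    {s : ι → ℝ} (hs : s ≠ 0) :
    (B *ᵥ s) ⬝ᵥ G⁻¹ *ᵥ (B *ᵥ s) = (s ⬝ᵥ G *ᵥ s) * ((s ⬝ᵥ B *ᵥ s) / (s ⬝ᵥ G *ᵥ s) *
      (potentialLoss G B s + 1 + Real.log ((s ⬝ᵥ B *ᵥ s) / (s ⬝ᵥ G *ᵥ s)))) := by
  have hq := posDef_quadratic_pos hB hs
  have hg := posDef_quadratic_pos hG hs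
  rw [potentialLoss]
  field_simp
  ring

lemma dual_norm_sub {G B : Matrix ι ι ℝ} (hG : G.PosDef) (s : ι → ℝ) :
    ((B - G) *ᵥ s) ⬝ᵥ G⁻¹ *ᵥ ((B - G) *ᵥ s) =
      (B *ᵥ s) ⬝ᵥ G⁻¹ *ᵥ (B *ᵥ s) - 2 * (s ⬝ᵥ B *ᵥ s) + s ⬝ᵥ G *ᵥ s := by
  have h := quadratic_sub_smul hG.inv.isHermitian (B *ᵥ s) (G *ᵥ s) 1
  rw [one_smul] at h
  rw [sub_mulVec, h, inv_mulVec_mulVec hG,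
    dotProduct_mulVec_comm_of_isHermitian hG.inv.isHermitian (G *ᵥ s), inv_mulVec_mulVec hG,
    dotProduct_comm (B *ᵥ s) s, dotProduct_comm (G *ᵥ s) s]
  ring

end Matrices

/-! ### The potential along BFGS steps in Euclidean space -/

section Bridge

open Matrix

variable {n : ℕ}

lemma inner_eq_dotProduct (v w : Vec n) : inner ℝ v w = v.ofLp ⬝ᵥ w.ofLp := by
  rw [EuclideanSpace.inner_eq_star_dotProduct, star_trivial, dotProduct_comm]

lemma ofLp_act (A : Matrix (Fin n) (Fin n) ℝ) (v : Vec n) : (act A v).ofLp = A *ᵥ v.ofLp :=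
  ofLp_toEuclideanCLM A v

lemma inner_act_eq (A : Matrix (Fin n) (Fin n) ℝ) (v w : Vec n) :
    inner ℝ v (act A w) = v.ofLp ⬝ᵥ A *ᵥ w.ofLp := by
  rw [inner_eq_dotProduct, ofLp_act]

lemma bfgsUpdate_eq (B : Matrix (Fin n) (Fin n) ℝ) (s γ : Vec n) :
    bfgsUpdate B s γ = bfgsCoord B s.ofLp γ.ofLp := by
  rw [bfgsUpdate, bfgsCoord, inner_act_eq, inner_eq_dotProduct]

lemma norm_act_le (A : Matrix (Fin n) (Fin n) ℝ) (v : Vec n) : ‖act A v‖ ≤ specNorm A * ‖v‖ :=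
  ContinuousLinearMap.le_opNorm _ v

lemma specNorm_nonneg (A : Matrix (Fin n) (Fin n) ℝ) : 0 ≤ specNorm A := norm_nonneg _

lemma act_smul (A : Matrix (Fin n) (Fin n) ℝ) (c : ℝ) (v : Vec n) :
    act A (c • v) = c • act A v := map_smul _ _ _

lemma act_add (A : Matrix (Fin n) (Fin n) ℝ) (v w : Vec n) :
    act A (v + w) = act A v + act A w := map_add _ _ _

lemma act_zero (A : Matrix (Fin n) (Fin n) ℝ) : act A 0 = 0 := map_zero _

lemma inner_act_comm {A : Matrix (Fin n) (Fin n) ℝ} (hA : A.IsHermitian) (v w : Vec n) :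
    inner ℝ v (act A w) = inner ℝ w (act A v) := by
  rw [inner_act_eq, inner_act_eq, dotProduct_mulVec_comm_of_isHermitian hA]

lemma inner_act_le (A : Matrix (Fin n) (Fin n) ℝ) (v : Vec n) :
    inner ℝ v (act A v) ≤ specNorm A * ‖v‖ ^ 2 := by
  have h1 := real_inner_le_norm v (act A v)
  have h2 := mul_le_mul_of_nonneg_left (norm_act_le A v) (norm_nonneg v)
  linarith [sq ‖v‖]

lemma posDef_inner_act_pos {A : Matrix (Fin n) (Fin n) ℝ} (hA : A.PosDef) {v : Vec n}
    (hv : v ≠ 0) : 0 < inner ℝ v (act A v) := by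
  rw [inner_act_eq]
  exact posDef_quadratic_pos hA (by simpa using hv)

lemma posDef_inner_act_nonneg {A : Matrix (Fin n) (Fin n) ℝ} (hA : A.PosDef) (v : Vec n) :
    0 ≤ inner ℝ v (act A v) := by
  rw [inner_act_eq]
  exact posDef_quadratic_nonneg hA _

/-- Coercivity of a positive definite matrix, by compactness of the unit sphere. -/
lemma posDef_exists_coercive {A : Matrix (Fin n) (Fin n) ℝ} (hA : A.PosDef) :
    ∃ c > 0, ∀ v : Vec n, c * ‖v‖ ^ 2 ≤ inner ℝ v (act A v) := by
  rcases (Metric.sphere (0 : Vec n) 1).eq_empty_or_nonempty with hE | hne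
  · refine ⟨1, one_pos, fun v ↦ ?_⟩
    have hv : v = 0 := by
      by_contra h
      have : ‖v‖⁻¹ • v ∈ Metric.sphere (0 : Vec n) 1 := by
        simp [norm_smul, h]
      simp [hE] at this
    simp [hv, act_zero]
  · have hcont : Continuous fun v : Vec n ↦ inner ℝ v (act A v) :=
      continuous_id.inner (ContinuousLinearMap.continuous _)
    obtain ⟨w, hw, hmin⟩ := (isCompact_sphere (0 : Vec n) 1).exists_isMinOn hne hcont.continuousOn
    have hw0 : w ≠ 0 := by rintro rfl; simp at hw
    refine ⟨_, posDef_inner_act_pos hA hw0, fun v ↦ ?_⟩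
    rcases eq_or_ne v 0 with rfl | hv
    · simp [act_zero]
    have hvn : ‖v‖ ≠ 0 := norm_ne_zero_iff.mpr hv
    have hmem : ‖v‖⁻¹ • v ∈ Metric.sphere (0 : Vec n) 1 := by
      simp [norm_smul, hv]
    have h : inner ℝ w (act A w) ≤ inner ℝ (‖v‖⁻¹ • v) (act A (‖v‖⁻¹ • v)) := hmin hmem
    rw [act_smul, real_inner_smul_left, real_inner_smul_right] at h
    calc _ ≤ (‖v‖⁻¹ * (‖v‖⁻¹ * inner ℝ v (act A v))) * ‖v‖ ^ 2 := by gcongr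
      _ = _ := by field_simp

/-- The BFGS formula preserves positive definiteness under the curvature condition. -/
lemma bfgsUpdate_posDef {B : Matrix (Fin n) (Fin n) ℝ} (hB : B.PosDef) {s γ : Vec n}
    (hγ : 0 < inner ℝ γ s) : (bfgsUpdate B s γ).PosDef := by
  rw [bfgsUpdate_eq]
  exact bfgsCoord_posDef hB (by rwa [← inner_eq_dotProduct])

/-- If `γ = Gs` up to a relative error `ε`, one BFGS step lowers the potential by the loss, up to
an error of order `ε`: the first-order terms of the trace and of the logarithm cancel. -/
lemma exists_potential_bfgsUpdate_le {G : Matrix (Fin n) (Fin n) ℝ} (hG : G.PosDef) :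
    ∃ C ≥ 0, ∃ ε₀ > 0, ∀ (B : Matrix (Fin n) (Fin n) ℝ) (s γ : Vec n) (ε : ℝ), B.PosDef →
      0 < inner ℝ γ s → 0 ≤ ε → ε ≤ ε₀ → ‖γ - act G s‖ ≤ ε * ‖s‖ →
      potential G (bfgsUpdate B s γ) ≤ potential G B - potentialLoss G B s.ofLp + C * ε := by
  obtain ⟨c, hc, hcG⟩ := posDef_exists_coercive hG
  set g := specNorm G⁻¹
  have hg0 : 0 ≤ g := specNorm_nonneg _
  refine ⟨2 * g / c, by positivity, min 1 (c / 2), by positivity, ?_⟩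
  intro B s γ ε hB hγ hε hε0 hdiff
  have hs : s ≠ 0 := by rintro rfl; simp at hγ
  have hsn : 0 < ‖s‖ := norm_pos_iff.mpr hs
  have hε1 : ε ≤ 1 := hε0.trans (min_le_left _ _)
  have hεc : ε ≤ c / 2 := hε0.trans (min_le_right _ _)
  set e := γ - act G s with he
  have hγe : γ = e + act G s := by rw [he]; abel
  set a := inner ℝ s (act G s) with ha
  set p := inner ℝ e s with hp
  set w := inner ℝ e (act G⁻¹ e) with hw
  have ha' : c * ‖s‖ ^ 2 ≤ a := hcG s
  have ha0 : 0 < a := posDef_inner_act_pos hG hs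
  have hp' : |p| ≤ ε * ‖s‖ ^ 2 := by
    have h1 := abs_real_inner_le_norm e s
    have h2 := mul_le_mul_of_nonneg_right hdiff hsn.le
    calc |p| ≤ _ := h1
      _ ≤ _ := h2
      _ = _ := by ring
  have hw' : w ≤ g * (ε * ‖s‖ ^ 2) := by
    have h1 := inner_act_le G⁻¹ e
    have h2 : ‖e‖ ^ 2 ≤ (ε * ‖s‖) ^ 2 := by gcongr
    have h3 : (ε * ‖s‖) ^ 2 ≤ ε * ‖s‖ ^ 2 := by
      have : ε ^ 2 ≤ ε := by nlinarith
      have := mul_le_mul_of_nonneg_right this (sq_nonneg ‖s‖)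
      linarith [mul_pow ε ‖s‖ 2]
    exact h1.trans (mul_le_mul_of_nonneg_left (h2.trans h3) hg0)
  have hγs : γ.ofLp ⬝ᵥ s.ofLp = a + p := by
    rw [← inner_eq_dotProduct, hγe, inner_add_left, real_inner_comm s (act G s)]
    ring
  have hGact : act G⁻¹ (act G s) = s := by
    apply (WithLp.ofLp_injective 2)
    rw [ofLp_act, ofLp_act, inv_mulVec_mulVec hG]
  have hγγ : γ.ofLp ⬝ᵥ G⁻¹ *ᵥ γ.ofLp = a + 2 * p + w := by
    rw [← inner_act_eq, hγe, act_add, inner_add_left, inner_add_right, inner_add_right,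
      inner_act_comm hG.inv.isHermitian (act G s) e, hGact, real_inner_comm s (act G s)]
    ring
  have hpos : 0 < a + p := by rw [← hγs, ← inner_eq_dotProduct]; exact hγ
  have hlow : c / 2 * ‖s‖ ^ 2 ≤ a + p := by
    have := neg_abs_le p
    have := mul_le_mul_of_nonneg_right hεc (sq_nonneg ‖s‖)
    linarith
  rw [bfgsUpdate_eq, potential_bfgsCoord hG hB (by rwa [hγs]), hγs, hγγ, ← inner_act_eq, ← ha]
  have hlog := Real.log_le_sub_one_of_pos (div_pos ha0 hpos)
  have heq : (a + 2 * p + w) / (a + p) - 1 + (a / (a + p) - 1) = w / (a + p) := by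
    field_simp; ring
  have hfin : w / (a + p) ≤ 2 * g / c * ε := by
    rw [div_le_iff₀ hpos]
    calc w ≤ g * (ε * ‖s‖ ^ 2) := hw'
      _ = 2 * g / c * ε * (c / 2 * ‖s‖ ^ 2) := by field_simp
      _ ≤ _ := by gcongr
  linarith

/-- A loss of at most `1` bounds the curvature of `B` along `s` from both sides. -/
lemma exists_bounds_of_potentialLoss_le_one {G : Matrix (Fin n) (Fin n) ℝ} (hG : G.PosDef) :
    ∃ a > 0, ∃ b > 0, ∀ (B : Matrix (Fin n) (Fin n) ℝ) (s : Vec n), B.PosDef → s ≠ 0 →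
      potentialLoss G B s.ofLp ≤ 1 →
      a * ‖s‖ ^ 2 ≤ inner ℝ s (act B s) ∧ ‖act B s‖ ≤ b * ‖s‖ := by
  obtain ⟨c, hc, hcG⟩ := posDef_exists_coercive hG
  obtain ⟨c', hc', hcG'⟩ := posDef_exists_coercive hG.inv
  set L := specNorm G
  have hL0 : 0 ≤ L := specNorm_nonneg _
  refine ⟨Real.exp (-2) * c, by positivity, √(L * 20 / c') + 1, by positivity, ?_⟩
  intro B s hB hs hloss
  have hs' : s.ofLp ≠ 0 := by simpa using hs
  have hsub := sub_one_sub_log_le_potentialLoss hG hB hs'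
  have hdual := dual_norm_eq_of_potentialLoss hG hB hs'
  rw [← ofLp_act, ← inner_act_eq, ← inner_act_eq, ← inner_eq_dotProduct] at hdual
  rw [← inner_act_eq, ← inner_act_eq] at hsub
  have hq : 0 < inner ℝ s (act B s) := posDef_inner_act_pos hB hs
  have hg : 0 < inner ℝ s (act G s) := posDef_inner_act_pos hG hs
  set u := inner ℝ s (act B s) / inner ℝ s (act G s) with hu
  have hu0 : 0 < u := div_pos hq hg
  have hqu : inner ℝ s (act B s) = u * inner ℝ s (act G s) := by rw [hu]; field_simp
  have hlow : Real.exp (-2) ≤ u := by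
    rw [← Real.le_log_iff_exp_le hu0]; linarith
  have hlogu := Real.log_le_sub_one_of_pos hu0
  -- the bound `log u ≤ u / 2` turns `u - 1 - log u ≤ 1` into `u ≤ 4`
  have hlog2 : Real.log u ≤ u / 2 := by
    have h1 := Real.log_le_sub_one_of_pos (half_pos hu0)
    rw [Real.log_div hu0.ne' two_ne_zero] at h1
    have h2 := Real.log_le_sub_one_of_pos (two_pos (α := ℝ))
    linarith
  have hup : u ≤ 4 := by linarith
  constructor
  · rw [hqu]
    calc _ = Real.exp (-2) * (c * ‖s‖ ^ 2) := by ring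
      _ ≤ _ := mul_le_mul hlow (hcG s) (by positivity) hu0.le
  · have h1 := hcG' (act B s)
    have h2 : inner ℝ (act B s) (act G⁻¹ (act B s)) ≤ L * ‖s‖ ^ 2 * 20 := by
      rw [hdual]
      refine mul_le_mul (inner_act_le G s) ?_ ?_ (by positivity)
      · nlinarith
      · have := posDef_inner_act_nonneg hG.inv (act B s)
        rw [hdual] at this
        exact nonneg_of_mul_nonneg_right this hg
    have h3 : ‖act B s‖ ^ 2 ≤ L * 20 / c' * ‖s‖ ^ 2 := by
      rw [div_mul_eq_mul_div, le_div_iff₀ hc']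
      linarith
    have h4 := Real.le_sqrt_of_sq_le h3
    rw [Real.sqrt_mul (by positivity), Real.sqrt_sq (norm_nonneg s)] at h4
    linarith [norm_nonneg s]

lemma tendsto_zero_of_sq_tendsto_zero {f : ℕ → ℝ}
    (h : Tendsto (fun k ↦ f k ^ 2) atTop (𝓝 0)) : Tendsto f atTop (𝓝 0) := by
  refine (tendsto_zero_iff_abs_tendsto_zero f).mpr ?_
  simpa [Real.sqrt_sq_eq_abs, Function.comp_def] using h.sqrt

/-- If the losses tend to zero, then `B` acts on the steps asymptotically as `G` does. -/
lemma tendsto_of_potentialLoss_tendsto_zero {G : Matrix (Fin n) (Fin n) ℝ} (hG : G.PosDef)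
    {B : ℕ → Matrix (Fin n) (Fin n) ℝ} {s : ℕ → Vec n} (hB : ∀ k, (B k).PosDef)
    (hs : ∀ k, s k ≠ 0)
    (hloss : Tendsto (fun k ↦ potentialLoss G (B k) (s k).ofLp) atTop (𝓝 0)) :
    Tendsto (fun k ↦ ‖act (B k - G) (s k)‖ / ‖s k‖) atTop (𝓝 0) := by
  obtain ⟨c', hc', hcG'⟩ := posDef_exists_coercive hG.inv
  set L := specNorm G
  set t := fun k ↦ potentialLoss G (B k) (s k).ofLp with ht
  set u := fun k ↦ inner ℝ (s k) (act (B k) (s k)) / inner ℝ (s k) (act G (s k)) with hu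
  have hq k : 0 < inner ℝ (s k) (act (B k) (s k)) := posDef_inner_act_pos (hB k) (hs k)
  have hg k : 0 < inner ℝ (s k) (act G (s k)) := posDef_inner_act_pos hG (hs k)
  have hu0 k : 0 < u k := div_pos (hq k) (hg k)
  have hs' k : (s k).ofLp ≠ 0 := by simpa using hs k
  -- `log u ≤ 2 (√u - 1)` gives `(√u - 1)² ≤ u - 1 - log u ≤ t`
  have hsq k : (√(u k) - 1) ^ 2 ≤ t k := by
    have h1 := sub_one_sub_log_le_potentialLoss hG (hB k) (hs' k)
    rw [← inner_act_eq, ← inner_act_eq] at h1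
    have h2 := Real.log_le_sub_one_of_pos (Real.sqrt_pos.mpr (hu0 k))
    rw [Real.log_sqrt (hu0 k).le] at h2
    have h3 := Real.sq_sqrt (hu0 k).le
    calc (√(u k) - 1) ^ 2 = u k - 2 * √(u k) + 1 := by rw [sub_sq, h3]; ring
      _ ≤ u k - 1 - Real.log (u k) := by linarith
      _ ≤ t k := h1
  have hut : Tendsto u atTop (𝓝 1) := by
    have h1 : Tendsto (fun k ↦ (√(u k) - 1) ^ 2) atTop (𝓝 0) :=
      squeeze_zero (fun k ↦ sq_nonneg _) hsq hloss
    have h2 := tendsto_zero_of_sq_tendsto_zero h1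
    have h3 := (h2.add_const 1).pow 2
    refine (h3.congr fun k ↦ ?_).trans (by norm_num)
    rw [sub_add_cancel, Real.sq_sqrt (hu0 k).le]
  set E := fun k ↦ u k * (t k + 1 + Real.log (u k)) - 2 * u k + 1 with hE
  have hEt : Tendsto E atTop (𝓝 0) := by
    have hl : Tendsto (fun k ↦ Real.log (u k)) atTop (𝓝 0) := by
      simpa using hut.log one_ne_zero
    have := ((hut.mul ((hloss.add_const 1).add hl)).sub (hut.const_mul 2)).add_const 1
    convert this using 2
    norm_num
  have hbound k : (‖act (B k - G) (s k)‖ / ‖s k‖) ^ 2 ≤ L / c' * |E k| := by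
    have hsn : 0 < ‖s k‖ := norm_pos_iff.mpr (hs k)
    have h1 := hcG' (act (B k - G) (s k))
    have h2 := dual_norm_sub (B := B k) hG (s k).ofLp
    rw [dual_norm_eq_of_potentialLoss hG (hB k) (hs' k), ← ofLp_act, ← ofLp_act,
      ← inner_act_eq, ← inner_act_eq, ← inner_eq_dotProduct] at h2
    have h3 : inner ℝ (act (B k - G) (s k)) (act G⁻¹ (act (B k - G) (s k))) =
        inner ℝ (s k) (act G (s k)) * E k := by
      rw [h2]
      have : inner ℝ (s k) (act (B k) (s k)) = inner ℝ (s k) (act G (s k)) * u k := by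
        have := (hg k).ne'
        simp only [hu]; field_simp
      rw [hE]
      simp only [ht]
      rw [this, mul_div_cancel_left₀ _ (hg k).ne']
      ring
    have h4 : inner ℝ (s k) (act G (s k)) * E k ≤ L * ‖s k‖ ^ 2 * |E k| :=
      (mul_le_mul_of_nonneg_left (le_abs_self _) (hg k).le).trans
        (mul_le_mul_of_nonneg_right (inner_act_le G (s k)) (abs_nonneg _))
    rw [div_pow, div_le_iff₀ (by positivity), div_mul_eq_mul_div, div_mul_eq_mul_div,
      le_div_iff₀ hc']
    linarith
  refine tendsto_zero_of_sq_tendsto_zero (squeeze_zero (fun k ↦ sq_nonneg _) hbound ?_)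
  simpa using hEt.abs.const_mul (L / c')

end Bridge

/-! ### Gradient and Taylor estimates near the limit -/

section Analysis

variable {n m : ℕ} {F : Vec n → Vec m}

lemma contDiff_component (hF : ContDiff ℝ 2 F) (j : Fin m) : ContDiff ℝ 2 fun y ↦ F y j :=
  contDiff_euclidean.mp hF j

lemma hasFDerivAt_component (hF : ContDiff ℝ 2 F) (j : Fin m) (x : Vec n) :
    HasFDerivAt (fun y ↦ F y j) (InnerProductSpace.toDual ℝ (Vec n) (grad F j x)) x :=
  (((contDiff_component hF j).differentiable (by norm_num)) x).hasGradientAt.hasFDerivAt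

lemma differentiable_grad (hF : ContDiff ℝ 2 F) (j : Fin m) : Differentiable ℝ (grad F j) := by
  have h : ContDiff ℝ 1 (fderiv ℝ fun y ↦ F y j) :=
    (contDiff_component hF j).fderiv_right (by norm_num)
  have h2 : Differentiable ℝ fun x ↦
      (InnerProductSpace.toDual ℝ (Vec n)).symm (fderiv ℝ (fun y ↦ F y j) x) :=
    (InnerProductSpace.toDual ℝ (Vec n)).symm.toContinuousLinearEquiv.differentiable.comp
      (h.differentiable (by norm_num))
  exact h2

lemma fderiv_grad (x : Vec n) (j : Fin m) :
    fderiv ℝ (grad F j) x = Matrix.toEuclideanCLM (n := Fin n) (𝕜 := ℝ) (hess F j x) := by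
  ext v a
  have hv : v = ∑ b, v b • EuclideanSpace.single b (1 : ℝ) := by
    ext i
    simp [Finset.sum_apply, Pi.single_apply]
  rw [Matrix.ofLp_toEuclideanCLM, Matrix.mulVec, dotProduct]
  conv_lhs => rw [hv, map_sum]
  simp only [map_smul, WithLp.ofLp_sum, Finset.sum_apply, PiLp.smul_apply, smul_eq_mul, hess,
    Matrix.of_apply]
  exact Finset.sum_congr rfl fun b _ ↦ mul_comm _ _

/-- Mean value inequality for `∇F_j - G`: if the Hessian is `δ`-close to `G` on a convex set, then
gradient differences are `δ`-close to those of the quadratic function with Hessian `G`. -/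
lemma norm_grad_sub_sub_act_le (hF : ContDiff ℝ 2 F) {j : Fin m} {s : Set (Vec n)}
    (hs : Convex ℝ s) {G : Matrix (Fin n) (Fin n) ℝ} {δ : ℝ}
    (hδ : ∀ y ∈ s, specNorm (hess F j y - G) ≤ δ) {z w : Vec n} (hz : z ∈ s) (hw : w ∈ s) :
    ‖grad F j z - grad F j w - act G (z - w)‖ ≤ δ * ‖z - w‖ := by
  refine hs.norm_image_sub_le_of_norm_fderiv_le' (𝕜 := ℝ)
    (fun y _ ↦ differentiable_grad hF j y) (fun y hy ↦ ?_) hw hz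
  rw [fderiv_grad, ← map_sub]
  exact hδ y hy

/-- Second-order Taylor estimate with a fixed matrix `G` in place of the Hessian. -/
lemma abs_taylor_remainder_le (hF : ContDiff ℝ 2 F) {j : Fin m} {s : Set (Vec n)}
    (hs : Convex ℝ s) {G : Matrix (Fin n) (Fin n) ℝ} (hG : G.IsHermitian) {δ : ℝ}
    (hδ : ∀ y ∈ s, specNorm (hess F j y - G) ≤ δ) {z w : Vec n} (hz : z ∈ s) (hw : w ∈ s) :
    |F z j - F w j - inner ℝ (grad F j w) (z - w) - 1 / 2 * inner ℝ (z - w) (act G (z - w))|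
      ≤ δ * ‖z - w‖ ^ 2 := by
  have hδ0 : 0 ≤ δ := (specNorm_nonneg _).trans (hδ z hz)
  set A := Matrix.toEuclideanCLM (n := Fin n) (𝕜 := ℝ) G with hA
  let h : Vec n → ℝ := fun y ↦
    F y j - inner ℝ (grad F j w) (y - w) - 1 / 2 * inner ℝ (y - w) (A (y - w))
  have hder : ∀ y, HasFDerivAt h
      (InnerProductSpace.toDual ℝ (Vec n) (grad F j y - grad F j w - A (y - w))) y := by
    intro y
    have hsub : HasFDerivAt (fun y : Vec n ↦ y - w) (ContinuousLinearMap.id ℝ (Vec n)) y :=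
      (hasFDerivAt_id y).sub_const w
    have h1 := hasFDerivAt_component hF j y
    have h2 := (hasFDerivAt_const (grad F j w) y).inner ℝ hsub
    have h3 := (hsub.inner ℝ (A.hasFDerivAt.comp y hsub)).const_mul (1 / 2)
    have h4 := (h1.sub h2).sub h3
    refine h4.congr_fderiv ?_
    ext v
    have hsymm : inner ℝ (y - w) (A v) = inner ℝ v (A (y - w)) := inner_act_comm hG _ _
    simp only [sub_apply, InnerProductSpace.toDual_apply_apply,
      ContinuousLinearMap.comp_apply, ContinuousLinearMap.prod_apply, fderivInnerCLM_apply,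
      smul_apply, zero_apply, inner_zero_left,
      ContinuousLinearMap.id_apply, inner_sub_left, smul_eq_mul, Function.comp_apply] at hsymm ⊢
    simp only [map_sub, inner_sub_left, inner_sub_right] at hsymm ⊢
    rw [real_inner_comm v (A y), real_inner_comm v (A w)]
    linarith
  have hbound : ∀ y ∈ segment ℝ w z, ‖InnerProductSpace.toDual ℝ (Vec n)
      (grad F j y - grad F j w - A (y - w))‖ ≤ δ * ‖z - w‖ := by
    intro y hy
    rw [LinearIsometryEquiv.norm_map]
    refine (norm_grad_sub_sub_act_le hF hs hδ (hs.segment_subset hw hz hy) hw).trans ?_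
    gcongr
    rw [segment_eq_image'] at hy
    obtain ⟨θ, ⟨h0, h1⟩, rfl⟩ := hy
    rw [add_sub_cancel_left, norm_smul, Real.norm_of_nonneg h0]
    exact mul_le_of_le_one_left (norm_nonneg _) h1
  have := (convex_segment w z).norm_image_sub_le_of_norm_hasFDerivWithin_le
    (fun y _ ↦ (hder y).hasFDerivWithinAt) hbound (left_mem_segment ℝ w z)
    (right_mem_segment ℝ w z)
  have hval : h z - h w = F z j - F w j - inner ℝ (grad F j w) (z - w)
      - 1 / 2 * inner ℝ (z - w) (act G (z - w)) := by
    simp only [h, sub_self, map_zero, inner_zero_right]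
    rw [hA, act]
    ring
  rw [← hval, ← Real.norm_eq_abs]
  calc _ ≤ _ := this
    _ = _ := by ring

lemma eventually_specNorm_hess_sub_le {j : Fin m} {z : Vec n} (h : HessHolderAt F j z) {δ : ℝ}
    (hδ : 0 < δ) : ∀ᶠ x in 𝓝 z, specNorm (hess F j x - hess F j z) ≤ δ := by
  obtain ⟨ν, hν, M, hM, hev⟩ := h
  have hlim : Tendsto (fun x ↦ M * ‖x - z‖ ^ ν) (𝓝 z) (𝓝 0) := by
    have h1 : Tendsto (fun x : Vec n ↦ ‖x - z‖) (𝓝 z) (𝓝 0) := by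
      simpa using (tendsto_id (x := 𝓝 z)).sub_const z |>.norm
    simpa [Real.zero_rpow hν.1.ne'] using (h1.rpow_const (Or.inr hν.1.le)).const_mul M
  filter_upwards [hev, hlim.eventually_le_const hδ] with x h1 h2
  exact h1.trans h2

/-- On the ball of radius `ε` around `z` the component `F_j` exceeds its linearizations by at
least `ε ‖y - x‖²` and at most `1 / ε ‖y - x‖²`, and its gradient is Lipschitz with constant
`1 / ε`. One parameter `ε` stands for all the constants, so that they can be chosen simultaneously for all `j`. -/
def LocalBounds (F : Vec n → Vec m) (z : Vec n) (ε : ℝ) (j : Fin m) : Prop :=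
  ∀ x ∈ Metric.ball z ε, ∀ y ∈ Metric.ball z ε,
    ‖grad F j x - grad F j y‖ ≤ 1 / ε * ‖x - y‖ ∧
    F x j + inner ℝ (grad F j x) (y - x) + ε * ‖y - x‖ ^ 2 ≤ F y j ∧
    F x j ≤ F y j + inner ℝ (grad F j y) (x - y) + 1 / ε * ‖x - y‖ ^ 2

lemma eventually_localBounds (hF : ContDiff ℝ 2 F) {z : Vec n} {j : Fin m}
    (hpos : (hess F j z).PosDef) (hh : HessHolderAt F j z) :
    ∀ᶠ ε in 𝓝[>] (0 : ℝ), LocalBounds F z ε j := by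
  obtain ⟨c, hc, hcG⟩ := posDef_exists_coercive hpos
  set L := specNorm (hess F j z)
  have hL : 0 ≤ L := specNorm_nonneg _
  obtain ⟨r, hr, hball⟩ := Metric.eventually_nhds_iff_ball.mp
    (eventually_specNorm_hess_sub_le hh (show 0 < c / 4 by positivity))
  have hinv : ∀ᶠ ε in 𝓝[>] (0 : ℝ), L + c ≤ ε⁻¹ :=
    tendsto_inv_nhdsGT_zero.eventually_ge_atTop _
  filter_upwards [hinv, Ioo_mem_nhdsGT hr, Ioo_mem_nhdsGT (show 0 < c / 4 by positivity)]
    with ε h1 h2 h3 x hx y hy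
  have hx' : x ∈ Metric.ball z r := Metric.ball_subset_ball h2.2.le hx
  have hy' : y ∈ Metric.ball z r := Metric.ball_subset_ball h2.2.le hy
  rw [← one_div] at h1
  refine ⟨?_, ?_, ?_⟩
  · have h := norm_grad_sub_sub_act_le hF (convex_ball z r) hball hx' hy'
    have h' := norm_act_le (hess F j z) (x - y)
    calc ‖grad F j x - grad F j y‖
        = ‖(grad F j x - grad F j y - act (hess F j z) (x - y)) + act (hess F j z) (x - y)‖ := by
          rw [sub_add_cancel]
      _ ≤ c / 4 * ‖x - y‖ + L * ‖x - y‖ := (norm_add_le _ _).trans (add_le_add h h')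
      _ = (L + c / 4) * ‖x - y‖ := by ring
      _ ≤ 1 / ε * ‖x - y‖ := by gcongr; linarith
  · have h := (abs_le.mp (abs_taylor_remainder_le hF (convex_ball z r) hpos.isHermitian hball
      hy' hx')).1
    have h' := hcG (y - x)
    have h'' : ε * ‖y - x‖ ^ 2 ≤ c / 4 * ‖y - x‖ ^ 2 := by gcongr; exact h3.2.le
    linarith
  · have h := (abs_le.mp (abs_taylor_remainder_le hF (convex_ball z r) hpos.isHermitian hball
      hx' hy')).2
    have h' := inner_act_le (hess F j z) (x - y)
    have h'' : (L + c) * ‖x - y‖ ^ 2 ≤ 1 / ε * ‖x - y‖ ^ 2 := by gcongr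
    have h3 := mul_nonneg hL (sq_nonneg ‖x - y‖)
    have h4 := mul_nonneg hc.le (sq_nonneg ‖x - y‖)
    change inner ℝ (x - y) (act (hess F j z) (x - y)) ≤ L * ‖x - y‖ ^ 2 at h'
    linarith

/-- Under the Hölder condition, gradient differences near `z` agree with `∇²F_j(z)(x' - x)` up to
the relative error `M (‖x - z‖ ^ ν + ‖x' - z‖ ^ ν)`. -/
lemma exists_norm_gradDiff_sub_le (hF : ContDiff ℝ 2 F) {z : Vec n} {j : Fin m}
    (hh : HessHolderAt F j z) :
    ∃ ν > (0 : ℝ), ∃ M > (0 : ℝ), ∃ r > 0, ∀ x ∈ Metric.ball z r, ∀ x' ∈ Metric.ball z r,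
      ‖gradDiff F x x' j - act (hess F j z) (x' - x)‖ ≤
        M * (‖x - z‖ ^ ν + ‖x' - z‖ ^ ν) * ‖x' - x‖ := by
  obtain ⟨ν, hν, M, hM, hev⟩ := hh
  obtain ⟨r, hr, hball⟩ := Metric.eventually_nhds_iff_ball.mp hev
  refine ⟨ν, hν.1, M, hM, r, hr, fun x hx x' hx' ↦ ?_⟩
  set ρ := max ‖x - z‖ ‖x' - z‖ with hρ
  have hρr : ρ < r := by
    rw [hρ, max_lt_iff, ← dist_eq_norm, ← dist_eq_norm]
    exact ⟨hx, hx'⟩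
  have h := norm_grad_sub_sub_act_le (δ := M * ρ ^ ν) (G := hess F j z) hF (j := j)
    (convex_closedBall z ρ) (fun y hy ↦ ?_) (z := x') (w := x)
    (by rw [mem_closedBall_iff_norm]; exact le_max_right _ _)
    (by rw [mem_closedBall_iff_norm]; exact le_max_left _ _)
  · refine h.trans ?_
    have : ρ ^ ν ≤ ‖x - z‖ ^ ν + ‖x' - z‖ ^ ν := by
      have h1 : 0 ≤ ‖x - z‖ ^ ν := by positivity
      have h2 : 0 ≤ ‖x' - z‖ ^ ν := by positivity
      rcases max_choice ‖x - z‖ ‖x' - z‖ with h | h <;> rw [hρ, h] <;> linarith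
    gcongr
  · rw [mem_closedBall_iff_norm] at hy
    refine (hball y ?_).trans ?_
    · rw [mem_ball_iff_norm]; exact hy.trans_lt hρr
    · have := hν.1.le
      gcongr

end Analysis

/-! ### Gordan's alternative and the direction subproblem -/

section Optimality

/-- Gordan's alternative: if no direction has a negative inner product with every `g j`, then `0`
is a convex combination of the `g j`. Otherwise `0` could be separated from their convex hull. -/
lemma exists_stdSimplex_sum_smul_eq_zero {ι E : Type*} [Fintype ι] [NormedAddCommGroup E]
    [InnerProductSpace ℝ E] [CompleteSpace E] {g : ι → E}
    (h : ¬ ∃ e, ∀ j, inner ℝ (g j) e < 0) : ∃ w ∈ stdSimplex ℝ ι, ∑ j, w j • g j = 0 := by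
  classical
  let T : (ι → ℝ) →ₗ[ℝ] E := ∑ j, (LinearMap.proj (R := ℝ) j).smulRight (g j)
  have hT : ∀ w, T w = ∑ j, w j • g j := fun w ↦ by simp [T]
  have hTc : Continuous T := by
    have : (T : (ι → ℝ) → E) = fun w ↦ ∑ j, w j • g j := funext hT
    rw [this]
    fun_prop
  by_contra hcon
  have h0 : (0 : E) ∉ T '' stdSimplex ℝ ι := by
    rintro ⟨w, hw, hw0⟩
    exact hcon ⟨w, hw, by rw [← hT, hw0]⟩
  obtain ⟨f, u, hf0, hfu⟩ := geometric_hahn_banach_point_closed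
    ((convex_stdSimplex ℝ ι).linear_image T) ((isCompact_stdSimplex ℝ ι).image hTc).isClosed h0
  rw [map_zero] at hf0
  refine h ⟨-(InnerProductSpace.toDual ℝ E).symm f, fun j ↦ ?_⟩
  have hj := hfu (g j) ⟨Pi.single j 1, single_mem_stdSimplex ℝ j, by
    rw [hT]
    simp [Pi.single_apply]⟩
  rw [inner_neg_right, real_inner_comm, InnerProductSpace.toDual_symm_apply]
  linarith

variable {n m : ℕ} {F : Vec n → Vec m} {B : Fin m → Matrix (Fin n) (Fin n) ℝ} {x d : Vec n}

lemma inner_le_maxSlope (F : Vec n → Vec m) (x d : Vec n) (j : Fin m) :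
    inner ℝ (grad F j x) d ≤ maxSlope F x d :=
  le_ciSup (f := fun j ↦ inner ℝ (grad F j x) d) (Set.finite_range _).bddAbove j

lemma le_modelValue (F : Vec n → Vec m) (B : Fin m → Matrix (Fin n) (Fin n) ℝ) (x d : Vec n)
    (j : Fin m) :
    inner ℝ (grad F j x) d + 1 / 2 * inner ℝ d (act (B j) d) ≤ modelValue F B x d :=
  le_ciSup (f := fun j ↦ inner ℝ (grad F j x) d + 1 / 2 * inner ℝ d (act (B j) d))
    (Set.finite_range _).bddAbove j

lemma modelValue_zero [Nonempty (Fin m)] : modelValue F B x 0 = 0 := by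
  simp [modelValue]

/-- The minimizer of the direction subproblem is a descent direction for every objective. -/
lemma inner_le_of_isMinOn [Nonempty (Fin m)] (hd : IsMinOn (modelValue F B x) Set.univ d)
    (j : Fin m) : inner ℝ (grad F j x) d ≤ -(1 / 2) * inner ℝ d (act (B j) d) := by
  have h1 : modelValue F B x d ≤ modelValue F B x 0 := hd (Set.mem_univ _)
  rw [modelValue_zero] at h1
  linarith [le_modelValue F B x d j]

/-- Stationarity for the direction subproblem: some convex combination of the gradients
`∇F_j(x) + B_j d` of the models vanishes. Otherwise, by Gordan's alternative for the active models,
there is a direction in which the maximum decreases. -/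
lemma exists_multipliers_of_isMinOn [Nonempty (Fin m)] (hB : ∀ j, (B j).IsHermitian)
    (hd : IsMinOn (modelValue F B x) Set.univ d) :
    ∃ w ∈ stdSimplex ℝ (Fin m), ∑ j, w j • (grad F j x + act (B j) d) = 0 := by
  classical
  let q : Fin m → Vec n → ℝ := fun j e ↦ inner ℝ (grad F j x) e + 1 / 2 * inner ℝ e (act (B j) e)
  have hqc : ∀ j, Continuous (q j) := fun j ↦
    (continuous_const.inner continuous_id).add
      ((continuous_id.inner (ContinuousLinearMap.continuous _)).const_mul _)
  let A := {j : Fin m // q j d = modelValue F B x d}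
  have hgordan : ¬ ∃ e, ∀ j : A, inner ℝ (grad F j x + act (B j) d) e < 0 := by
    rintro ⟨e, he⟩
    have hexp : ∀ j (t : ℝ), q j (d + t • e) =
        q j d + t * (inner ℝ (grad F j x + act (B j) d) e +
          t * (1 / 2 * inner ℝ e (act (B j) e))) := by
      intro j t
      simp only [q, act_add, act_smul, inner_add_left, inner_add_right, real_inner_smul_left,
        real_inner_smul_right]
      rw [inner_act_comm (hB j) d e, real_inner_comm e (act (B j) d)]
      ring
    have hev : ∀ j, ∀ᶠ t in 𝓝[>] (0 : ℝ), q j (d + t • e) < modelValue F B x d := by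
      intro j
      by_cases hj : q j d = modelValue F B x d
      · have hlim : Tendsto (fun t : ℝ ↦ inner ℝ (grad F j x + act (B j) d) e
            + t * (1 / 2 * inner ℝ e (act (B j) e))) (𝓝[>] 0)
            (𝓝 (inner ℝ (grad F j x + act (B j) d) e + 0 * (1 / 2 * inner ℝ e (act (B j) e)))) :=
          ((tendsto_id.mono_left nhdsWithin_le_nhds).mul_const _).const_add _
        rw [zero_mul, add_zero] at hlim
        filter_upwards [hlim.eventually_lt_const (he ⟨j, hj⟩), self_mem_nhdsWithin] with t h1 h2
        rw [hexp, hj]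
        have := mul_neg_of_pos_of_neg h2 h1
        linarith
      · have hlt : q j (d + (0 : ℝ) • e) < modelValue F B x d := by
          rw [zero_smul, add_zero]
          exact lt_of_le_of_ne (le_modelValue F B x d j) hj
        have hc : ContinuousAt (fun t : ℝ ↦ q j (d + t • e)) 0 :=
          ((hqc j).comp (by fun_prop)).continuousAt
        exact (hc.eventually_lt_const hlt).filter_mono nhdsWithin_le_nhds
    obtain ⟨t, ht⟩ := (eventually_all.mpr hev).exists
    obtain ⟨j, hj⟩ := exists_eq_ciSup_of_finite (f := fun j ↦ q j (d + t • e))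
    have h1 : modelValue F B x d ≤ modelValue F B x (d + t • e) := hd (Set.mem_univ _)
    have h2 : q j (d + t • e) = modelValue F B x (d + t • e) := hj
    linarith [ht j]
  obtain ⟨w, hw, hw0⟩ := exists_stdSimplex_sum_smul_eq_zero hgordan
  -- extension of the weights by zero to the inactive models
  refine ⟨fun j ↦ ∑ a : A, if a.1 = j then w a else 0, ⟨fun j ↦ ?_, ?_⟩, ?_⟩
  · exact Finset.sum_nonneg fun a _ ↦ by split_ifs <;> [exact hw.1 a; exact le_rfl]
  · rw [Finset.sum_comm]
    simpa using hw.2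
  · simp_rw [Finset.sum_smul]
    rw [Finset.sum_comm]
    simpa [ite_smul, -smul_add] using hw0

/-- A convex combination of the gradients at a point that is not Pareto critical is not zero. -/
lemma sum_smul_grad_ne_zero (hx : ¬ IsParetoCritical F x) {w : Fin m → ℝ}
    (hw : w ∈ stdSimplex ℝ (Fin m)) : ∑ j, w j • grad F j x ≠ 0 := by
  intro h0
  obtain ⟨e, he⟩ := not_not.mp hx
  have h1 : ∑ j, w j * inner ℝ (grad F j x) e = 0 := by
    have := congrArg (fun v ↦ inner ℝ v e) h0
    simpa [sum_inner, real_inner_smul_left] using this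
  have h2 : ∀ j ∈ Finset.univ, w j * inner ℝ (grad F j x) e ≤ 0 := fun j _ ↦
    mul_nonpos_of_nonneg_of_nonpos (hw.1 j) (he j).le
  have h3 := (Finset.sum_eq_zero_iff_of_nonpos h2).mp h1
  have h4 : ∀ j, w j = 0 := fun j ↦
    (mul_eq_zero.mp (h3 j (Finset.mem_univ j))).resolve_right (he j).ne
  have h5 := hw.2
  simp [h4] at h5

/-- The search direction vanishes only at Pareto critical points. -/
lemma direction_ne_zero [Nonempty (Fin m)] (hB : ∀ j, (B j).IsHermitian)
    (hx : ¬ IsParetoCritical F x) (hd : IsMinOn (modelValue F B x) Set.univ d) : d ≠ 0 := by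
  rintro rfl
  obtain ⟨w, hw, hw0⟩ := exists_multipliers_of_isMinOn hB hd
  exact sum_smul_grad_ne_zero hx hw (by simpa [act_zero] using hw0)

end Optimality

/-! ### Sequences controlled by a potential -/

section Sequences

/-- A Lyapunov argument: `Φ` never increases and contracts whenever `T ≤ 1`, while `Ψ` pays for the
steps with `T` large. Then `Φ exp (κ Ψ)`, for a suitable `κ`, decreases geometrically. -/
lemma exists_geometric_bound {Φ Ψ T e : ℕ → ℝ} {c C : ℝ} (hc0 : 0 < c) (hc1 : c < 1)
    (hΦ : ∀ k, 0 ≤ Φ k) (hT : ∀ k, 0 ≤ T k) (hmono : ∀ k, Φ (k + 1) ≤ Φ k)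
    (hgood : ∀ k, T k ≤ 1 → Φ (k + 1) ≤ (1 - c) * Φ k)
    (hΨ : ∀ k, Ψ (k + 1) ≤ Ψ k - T k + e k) (he : ∀ k, e k ≤ 1 / 2) (hC : ∀ k, -C ≤ Ψ k) :
    ∃ A ≥ 0, ∃ q, 0 < q ∧ q < 1 ∧ ∀ k, Φ k ≤ A * q ^ k := by
  set κ := -Real.log (1 - c) with hκ
  have hκ0 : 0 < κ := by
    have := Real.log_neg (by linarith : 0 < 1 - c) (by linarith)
    linarith
  have hexpκ : Real.exp (-κ) = 1 - c := by rw [hκ, neg_neg, Real.exp_log (by linarith)]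
  have hstep : ∀ k, Φ (k + 1) ≤ Real.exp (-κ * (1 - T k)) * Φ k := by
    intro k
    by_cases hk : T k ≤ 1
    · refine (hgood k hk).trans (mul_le_mul_of_nonneg_right ?_ (hΦ k))
      rw [← hexpκ]
      exact Real.exp_le_exp.mpr (by nlinarith [mul_nonneg hκ0.le (hT k)])
    · refine (hmono k).trans (le_mul_of_one_le_left (hΦ k) (Real.one_le_exp ?_))
      push Not at hk
      nlinarith
  have hW : ∀ k, Φ k * Real.exp (κ * Ψ k) ≤
      (Φ 0 * Real.exp (κ * Ψ 0)) * Real.exp (-κ / 2) ^ k := by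
    intro k
    induction k with
    | zero => simp
    | succ k ih =>
      calc Φ (k + 1) * Real.exp (κ * Ψ (k + 1))
          ≤ (Real.exp (-κ * (1 - T k)) * Φ k) * Real.exp (κ * (Ψ k - T k + 1 / 2)) := by
            refine mul_le_mul (hstep k) ?_ (Real.exp_pos _).le
              (mul_nonneg (Real.exp_pos _).le (hΦ k))
            refine Real.exp_le_exp.mpr (mul_le_mul_of_nonneg_left ?_ hκ0.le)
            linarith [hΨ k, he k]
        _ = (Φ k * Real.exp (κ * Ψ k)) * Real.exp (-κ / 2) := by
            have : Real.exp (-κ * (1 - T k)) * Real.exp (κ * (Ψ k - T k + 1 / 2)) =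
                Real.exp (κ * Ψ k) * Real.exp (-κ / 2) := by
              rw [← Real.exp_add, ← Real.exp_add]
              congr 1
              ring
            calc _ = Φ k * (Real.exp (-κ * (1 - T k)) *
                  Real.exp (κ * (Ψ k - T k + 1 / 2))) := by ring
              _ = _ := by rw [this]; ring
        _ ≤ _ := by
            rw [pow_succ, ← mul_assoc]
            exact mul_le_mul_of_nonneg_right ih (Real.exp_pos _).le
  refine ⟨Φ 0 * Real.exp (κ * Ψ 0) * Real.exp (κ * C),
    mul_nonneg (mul_nonneg (hΦ 0) (Real.exp_pos _).le) (Real.exp_pos _).le,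
    Real.exp (-κ / 2), Real.exp_pos _, ?_, fun k ↦ ?_⟩
  · rw [← Real.exp_zero]
    exact Real.exp_lt_exp.mpr (by linarith)
  · have h1 : 1 ≤ Real.exp (κ * Ψ k) * Real.exp (κ * C) := by
      rw [← Real.exp_add]
      refine Real.one_le_exp ?_
      have := mul_nonneg hκ0.le (by linarith [hC k] : 0 ≤ Ψ k + C)
      linarith
    calc Φ k ≤ Φ k * (Real.exp (κ * Ψ k) * Real.exp (κ * C)) :=
          le_mul_of_one_le_right (hΦ k) h1
      _ = (Φ k * Real.exp (κ * Ψ k)) * Real.exp (κ * C) := by ring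
      _ ≤ ((Φ 0 * Real.exp (κ * Ψ 0)) * Real.exp (-κ / 2) ^ k) * Real.exp (κ * C) :=
          mul_le_mul_of_nonneg_right (hW k) (Real.exp_pos _).le
      _ = _ := by ring

lemma summable_rpow_of_sq_le_geometric {u : ℕ → ℝ} {A q ν : ℝ} (hu : ∀ k, 0 ≤ u k) (hA : 0 ≤ A)
    (hq0 : 0 < q) (hq1 : q < 1) (hν : 0 < ν) (h : ∀ k, u k ^ 2 ≤ A * q ^ k) :
    Summable fun k ↦ u k ^ ν := by
  have hgeo : Summable fun k : ℕ ↦ A ^ (ν / 2) * (q ^ (ν / 2)) ^ k :=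
    (summable_geometric_of_lt_one (by positivity)
      (Real.rpow_lt_one hq0.le hq1 (by positivity))).mul_left _
  refine hgeo.of_nonneg_of_le (fun k ↦ Real.rpow_nonneg (hu k) ν) fun k ↦ ?_
  calc u k ^ ν = (u k ^ 2) ^ (ν / 2) := by
        rw [← Real.rpow_natCast, ← Real.rpow_mul (hu k)]
        congr 1
        push_cast
        ring
    _ ≤ (A * q ^ k) ^ (ν / 2) := Real.rpow_le_rpow (sq_nonneg _) (h k) (by positivity)
    _ = _ := by
        rw [Real.mul_rpow hA (by positivity), ← Real.rpow_natCast, ← Real.rpow_natCast,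
          ← Real.rpow_mul hq0.le, ← Real.rpow_mul hq0.le, mul_comm (ν / 2)]

/-- If `Ψ` is bounded below and its increments are at most `e - t` with `e` summable, then `t` is
summable. -/
lemma tendsto_zero_of_potential {Ψ t e : ℕ → ℝ} {C : ℝ} (ht : ∀ k, 0 ≤ t k) (he : ∀ k, 0 ≤ e k)
    (hsum : Summable e) (hΨ : ∀ k, Ψ (k + 1) ≤ Ψ k - t k + e k) (hC : ∀ k, -C ≤ Ψ k) :
    Tendsto t atTop (𝓝 0) := by
  have hind : ∀ K, ∑ k ∈ Finset.range K, t k ≤ Ψ 0 - Ψ K + ∑ k ∈ Finset.range K, e k := by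
    intro K
    induction K with
    | zero => simp
    | succ K ih =>
      rw [Finset.sum_range_succ, Finset.sum_range_succ]
      linarith [hΨ K]
  refine (summable_of_sum_range_le (c := Ψ 0 + C + ∑' k, e k) ht fun K ↦ ?_).tendsto_atTop_zero
  have := hsum.sum_le_tsum (Finset.range K) fun k _ ↦ he k
  linarith [hind K, hC K]

end Sequences

/-! ### Single steps of the algorithm -/

section Steps

variable {n m : ℕ} {F : Vec n → Vec m}

/-- At a local Pareto optimum some convex combination of the gradients vanishes. -/
lemma exists_multipliers_of_isLocalParetoOptimal [Nonempty (Fin m)] {z : Vec n} {ε : ℝ}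
    (hε : 0 < ε) (hloc : ∀ j, LocalBounds F z ε j) (hopt : IsLocalParetoOptimal F z) :
    ∃ w ∈ stdSimplex ℝ (Fin m), ∑ j, w j • grad F j z = 0 := by
  refine exists_stdSimplex_sum_smul_eq_zero ?_
  rintro ⟨e, he⟩
  obtain ⟨U, hU, hno⟩ := hopt
  have hcont : Tendsto (fun t : ℝ ↦ z + t • e) (𝓝[>] 0) (𝓝 z) := by
    have : Continuous fun t : ℝ ↦ z + t • e := by fun_prop
    have h := this.tendsto 0
    rw [zero_smul, add_zero] at h
    exact h.mono_left nhdsWithin_le_nhds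
  have hlt : ∀ j, ∀ᶠ t in 𝓝[>] (0 : ℝ), F (z + t • e) j < F z j := by
    intro j
    have hlim : Tendsto (fun t : ℝ ↦ inner ℝ (grad F j z) e + t * (1 / ε * ‖e‖ ^ 2)) (𝓝[>] 0)
        (𝓝 (inner ℝ (grad F j z) e + 0 * (1 / ε * ‖e‖ ^ 2))) :=
      ((tendsto_id.mono_left nhdsWithin_le_nhds).mul_const _).const_add _
    rw [zero_mul, add_zero] at hlim
    filter_upwards [hlim.eventually_lt_const (he j), self_mem_nhdsWithin,
      hcont.eventually (Metric.ball_mem_nhds z hε)] with t h1 (h2 : 0 < t) h3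
    have h4 := (hloc j _ h3 z (Metric.mem_ball_self hε)).2.2
    rw [add_sub_cancel_left, real_inner_smul_right, norm_smul, Real.norm_of_nonneg h2.le,
      mul_pow] at h4
    have := mul_neg_of_pos_of_neg h2 h1
    linarith
  obtain ⟨t, h1, h2⟩ := ((eventually_all.mpr hlt).and (hcont.eventually hU)).exists
  refine hno ⟨_, h2, fun j ↦ (h1 j).le, fun h ↦ ?_⟩
  obtain ⟨j⟩ := ‹Nonempty (Fin m)›
  exact (h1 j).ne (by rw [h])

/-- A Wolfe step in a direction `d` along which every `B_j` is bounded from both sides decreases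
every objective by a multiple of `‖x - z‖²`. The curvature condition bounds the step size from
below, and stationarity of the subproblem bounds `‖x - z‖` by `‖d‖`: the convex combination `φ` of
the objectives with the multipliers as weights satisfies `φ z ≤ φ x`, so that strong convexity gives
`ε ‖x - z‖² ≤ ⟪∇φ(x), x - z⟫`, while `‖∇φ(x)‖ ≤ b ‖d‖`. -/
lemma wolfe_step_decrease [Nonempty (Fin m)] {B : Fin m → Matrix (Fin n) (Fin n) ℝ}
    {x d z : Vec n} {ρ σ α ε a b : ℝ} (hρ : 0 < ρ) (hσ : σ < 1) (hα : 0 < α) (hε : 0 < ε)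
    (ha : 0 < a) (hb : 0 < b) (hloc : ∀ j, LocalBounds F z ε j)
    (hx : x ∈ Metric.ball z ε) (hx' : x + α • d ∈ Metric.ball z ε)
    (hB : ∀ j, (B j).IsHermitian) (hd : IsMinOn (modelValue F B x) Set.univ d) (hd0 : d ≠ 0)
    (hw : IsWolfeStep F ρ σ x d α) (hle : ∀ j, F z j ≤ F x j)
    (hlow : ∀ j, a * ‖d‖ ^ 2 ≤ inner ℝ d (act (B j) d)) (hup : ∀ j, ‖act (B j) d‖ ≤ b * ‖d‖)
    (j : Fin m) :
    F (x + α • d) j ≤ F x j - ρ * ((1 - σ) * (a / 2) ^ 2 * ε) * (ε / b) ^ 2 * ‖x - z‖ ^ 2 := by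
  have hdn : 0 < ‖d‖ := norm_pos_iff.mpr hd0
  set D := maxSlope F x d with hD
  have hDle : D ≤ -(a / 2) * ‖d‖ ^ 2 := by
    refine ciSup_le fun j ↦ ?_
    have h1 := inner_le_of_isMinOn hd j
    linarith [hlow j]
  have hD' : maxSlope F (x + α • d) d ≤ D + 1 / ε * α * ‖d‖ ^ 2 := by
    refine ciSup_le fun j ↦ ?_
    have h1 := (hloc j _ hx' _ hx).1
    rw [add_sub_cancel_left, norm_smul, Real.norm_of_nonneg hα.le] at h1
    have h2 := real_inner_le_norm (grad F j (x + α • d) - grad F j x) d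
    rw [inner_sub_left] at h2
    have h3 := mul_le_mul_of_nonneg_right h1 hdn.le
    have h4 := inner_le_maxSlope F x d j
    have h5 : 1 / ε * (α * ‖d‖) * ‖d‖ = 1 / ε * α * ‖d‖ ^ 2 := by ring
    linarith
  have hαlow : (1 - σ) * (a / 2) * ε ≤ α := by
    have h1 := hw.2.trans hD'
    have h2 : (1 - σ) * ((a / 2) * ‖d‖ ^ 2) ≤ 1 / ε * α * ‖d‖ ^ 2 := by
      have : (1 - σ) * ((a / 2) * ‖d‖ ^ 2) ≤ (1 - σ) * -D :=
        mul_le_mul_of_nonneg_left (by linarith) (by linarith)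
      linarith
    have h3 : (1 - σ) * (a / 2) ≤ 1 / ε * α :=
      le_of_mul_le_mul_right (by linarith : (1 - σ) * (a / 2) * ‖d‖ ^ 2 ≤ _) (by positivity)
    rw [one_div, inv_mul_eq_div, le_div_iff₀ hε] at h3
    exact h3
  have hdec : α * D ≤ -((1 - σ) * (a / 2) ^ 2 * ε) * ‖d‖ ^ 2 := by
    have h1 : α * D ≤ α * (-(a / 2) * ‖d‖ ^ 2) := mul_le_mul_of_nonneg_left hDle hα.le
    have h2 := mul_le_mul_of_nonneg_right hαlow (by positivity : 0 ≤ a / 2 * ‖d‖ ^ 2)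
    linarith
  have hdist : ε * ‖x - z‖ ≤ b * ‖d‖ := by
    obtain ⟨w, hws, hw0⟩ := exists_multipliers_of_isMinOn hB hd
    rcases eq_or_ne x z with rfl | hxz
    · simp only [sub_self, norm_zero, mul_zero]; positivity
    have hxz' : 0 < ‖x - z‖ := norm_pos_iff.mpr (sub_ne_zero.mpr hxz)
    have hj : ∀ j, ε * ‖x - z‖ ^ 2 ≤ inner ℝ (grad F j x) (x - z) := by
      intro j
      have h1 := (hloc j x hx z (Metric.mem_ball_self hε)).2.1
      rw [← neg_sub x z, inner_neg_right, norm_neg] at h1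
      linarith [hle j]
    have hsum : ∑ j, w j * (ε * ‖x - z‖ ^ 2) ≤ ∑ j, w j * (b * ‖d‖ * ‖x - z‖) := by
      calc ∑ j, w j * (ε * ‖x - z‖ ^ 2)
          ≤ ∑ j, w j * inner ℝ (grad F j x) (x - z) :=
            Finset.sum_le_sum fun j _ ↦ mul_le_mul_of_nonneg_left (hj j) (hws.1 j)
        _ = ∑ j, w j * -inner ℝ (act (B j) d) (x - z) := by
            have h := congrArg (fun v ↦ inner ℝ v (x - z)) hw0
            simp only [sum_inner, real_inner_smul_left, inner_add_left, inner_zero_left,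
              mul_add, Finset.sum_add_distrib] at h
            simp only [mul_neg, Finset.sum_neg_distrib]
            linarith
        _ ≤ _ := by
            refine Finset.sum_le_sum fun j _ ↦ mul_le_mul_of_nonneg_left ?_ (hws.1 j)
            have h1 := (abs_le.mp (abs_real_inner_le_norm (act (B j) d) (x - z))).1
            have h2 := mul_le_mul_of_nonneg_right (hup j) (norm_nonneg (x - z))
            linarith
    rw [← Finset.sum_mul, ← Finset.sum_mul, hws.2, one_mul, one_mul] at hsum
    refine le_of_mul_le_mul_right ?_ hxz'
    linarith [sq ‖x - z‖]
  have hsq : (ε / b) ^ 2 * ‖x - z‖ ^ 2 ≤ ‖d‖ ^ 2 := by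
    rw [← mul_pow]
    refine pow_le_pow_left₀ (by positivity) ?_ 2
    rw [div_mul_eq_mul_div, div_le_iff₀ hb]
    linarith
  have h1 := hw.1 j
  have h2 := mul_le_mul_of_nonneg_left hdec hρ.le
  have h3 := mul_le_mul_of_nonneg_left hsq
    (by have : 0 < 1 - σ := by linarith
        positivity : 0 ≤ ρ * ((1 - σ) * (a / 2) ^ 2 * ε))
  linarith

lemma correction_nonneg {ϑ : ℝ} (hϑ : 0 ≤ ϑ) (μ : Fin m → ℝ) (x x' : Vec n) (j : Fin m) :
    0 ≤ correction F ϑ μ x x' j :=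
  add_nonneg (le_max_right _ _) (mul_nonneg hϑ (norm_nonneg _))

/-- The correction term enforces the curvature condition. -/
lemma inner_correctedDiff_pos {ϑ : ℝ} (hϑ : 0 < ϑ) {μ : Fin m → ℝ} {x x' : Vec n} (hx : x' ≠ x)
    (hμ : ∑ i, μ i • grad F i x ≠ 0) (j : Fin m) :
    0 < inner ℝ (correctedDiff F ϑ μ x x' j) (x' - x) := by
  have hs : 0 < ‖x' - x‖ := norm_pos_iff.mpr (sub_ne_zero.mpr hx)
  have hη : inner ℝ (gradDiff F x x' j) (x' - x) = curvature F x x' j * ‖x' - x‖ ^ 2 := by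
    rw [curvature]; field_simp
  rw [correctedDiff, inner_add_left, real_inner_smul_left, real_inner_self_eq_norm_sq, hη,
    ← add_mul, correction]
  have h1 := le_max_left (-curvature F x x' j) 0
  have h2 : 0 < ϑ * ‖∑ i, μ i • grad F i x‖ := mul_pos hϑ (norm_pos_iff.mpr hμ)
  exact mul_pos (by linarith) (by positivity)

end Steps

/-! ### Runs of the algorithm -/

namespace IsRun

variable {n m : ℕ} {F : Vec n → Vec m} {ρ σ ϑlo ϑhi : ℝ} {x d : ℕ → Vec n} {α ϑ : ℕ → ℝ}
  {μ : ℕ → Fin m → ℝ} {B : ℕ → Fin m → Matrix (Fin n) (Fin n) ℝ} {z : Vec n}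

lemma theta_pos (h : IsRun F ρ σ ϑlo ϑhi x d α ϑ μ B) (k : ℕ) : 0 < ϑ k :=
  h.lo_pos.trans (h.theta_mem k).1

lemma step_eq (h : IsRun F ρ σ ϑlo ϑhi x d α ϑ μ B) (k : ℕ) : x (k + 1) - x k = α k • d k := by
  rw [h.next_iterate, add_sub_cancel_left]

lemma posDef [Nonempty (Fin m)] (h : IsRun F ρ σ ϑlo ϑhi x d α ϑ μ B) (k : ℕ) :
    ∀ j, (B k j).PosDef := by
  induction k with
  | zero => exact h.init_posDef
  | succ k ih =>
    intro j
    have hd : d k ≠ 0 :=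
      direction_ne_zero (fun j ↦ (ih j).isHermitian) (h.not_critical k) (h.direction k)
    rw [h.update]
    refine bfgsUpdate_posDef (ih j) (inner_correctedDiff_pos (h.theta_pos k) ?_
      (sum_smul_grad_ne_zero (h.not_critical k) (h.mu_mem k)) j)
    rw [← sub_ne_zero, h.step_eq]
    exact smul_ne_zero (h.step_pos k).ne' hd

lemma direction_ne_zero [Nonempty (Fin m)] (h : IsRun F ρ σ ϑlo ϑhi x d α ϑ μ B) (k : ℕ) :
    d k ≠ 0 :=
  MOBFGS.direction_ne_zero (fun j ↦ (h.posDef k j).isHermitian) (h.not_critical k) (h.direction k)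

lemma step_ne_zero [Nonempty (Fin m)] (h : IsRun F ρ σ ϑlo ϑhi x d α ϑ μ B) (k : ℕ) :
    x (k + 1) - x k ≠ 0 := by
  rw [h.step_eq]
  exact smul_ne_zero (h.step_pos k).ne' (h.direction_ne_zero k)

lemma antitone [Nonempty (Fin m)] (h : IsRun F ρ σ ϑlo ϑhi x d α ϑ μ B) (j : Fin m) :
    Antitone fun k ↦ F (x k) j := by
  refine antitone_nat_of_succ_le fun k ↦ ?_
  have h1 := (h.wolfe k).1 j
  rw [← h.next_iterate] at h1
  have h2 : maxSlope F (x k) (d k) ≤ 0 := ciSup_le fun j ↦ by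
    have := inner_le_of_isMinOn (h.direction k) j
    linarith [posDef_inner_act_nonneg (h.posDef k j) (d k)]
  have h3 := mul_nonpos_of_nonneg_of_nonpos (mul_pos h.rho_mem.1 (h.step_pos k)).le h2
  linarith

lemma limit_le [Nonempty (Fin m)] (h : IsRun F ρ σ ϑlo ϑhi x d α ϑ μ B) (hF : ContDiff ℝ 2 F)
    (hx : Tendsto x atTop (𝓝 z)) (j : Fin m) (k : ℕ) : F z j ≤ F (x k) j :=
  (h.antitone j).le_of_tendsto
    (((contDiff_component hF j).continuous.tendsto z).comp hx) k

/-- The error `e` in the potential recursion of one objective. It tends to zero because `x k → z`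
and the corrections do; if the distances to `z` have summable positive powers, then
`e` is summable. -/
lemma exists_potential_error [Nonempty (Fin m)] (h : IsRun F ρ σ ϑlo ϑhi x d α ϑ μ B)
    (hF : ContDiff ℝ 2 F) (hx : Tendsto x atTop (𝓝 z)) {j : Fin m} (hpos : (hess F j z).PosDef)
    (hh : HessHolderAt F j z)
    (hr : Summable fun k ↦ correction F (ϑ k) (μ k) (x k) (x (k + 1)) j) :
    ∃ e : ℕ → ℝ, (∀ k, 0 ≤ e k) ∧ Tendsto e atTop (𝓝 0) ∧
      (∀ᶠ k in atTop, potential (hess F j z) (B (k + 1) j) ≤ potential (hess F j z) (B k j)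
        - potentialLoss (hess F j z) (B k j) (x (k + 1) - x k).ofLp + e k) ∧
      ((∀ ν > 0, Summable fun k ↦ ‖x k - z‖ ^ (ν : ℝ)) → Summable e) := by
  obtain ⟨C, hC, ε₀, hε₀, hpot⟩ := exists_potential_bfgsUpdate_le hpos
  obtain ⟨ν, hν, M, hM, r, hr0, hdiff⟩ := exists_norm_gradDiff_sub_le hF hh
  set R := fun k ↦ correction F (ϑ k) (μ k) (x k) (x (k + 1)) j with hR
  have hR0 : ∀ k, 0 ≤ R k := fun k ↦ correction_nonneg (h.theta_pos k).le _ _ _ _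
  set δ := fun k ↦ M * (‖x k - z‖ ^ ν + ‖x (k + 1) - z‖ ^ ν) + R k with hδ
  have hδ0 : ∀ k, 0 ≤ δ k := fun k ↦ by
    have := hR0 k
    positivity
  have hx1 : Tendsto (fun k ↦ x (k + 1)) atTop (𝓝 z) := hx.comp (tendsto_add_atTop_nat 1)
  have hpow : ∀ {y : ℕ → Vec n}, Tendsto y atTop (𝓝 z) →
      Tendsto (fun k ↦ ‖y k - z‖ ^ ν) atTop (𝓝 0) := by
    intro y hy
    have h1 : Tendsto (fun k ↦ ‖y k - z‖) atTop (𝓝 0) := by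
      simpa using (hy.sub_const z).norm
    simpa [Real.zero_rpow hν.ne'] using h1.rpow_const (Or.inr hν.le)
  have hδt : Tendsto δ atTop (𝓝 0) := by
    simpa using (((hpow hx).add (hpow hx1)).const_mul M).add hr.tendsto_atTop_zero
  refine ⟨fun k ↦ C * δ k, fun k ↦ mul_nonneg hC (hδ0 k), by simpa using hδt.const_mul C, ?_, ?_⟩
  · filter_upwards [hδt.eventually_le_const hε₀, hx.eventually (Metric.ball_mem_nhds z hr0),
      hx1.eventually (Metric.ball_mem_nhds z hr0)] with k h1 h2 h3
    rw [h.update]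
    refine hpot (B k j) _ _ (δ k) (h.posDef k j) ?_ (hδ0 k) h1 ?_
    · exact inner_correctedDiff_pos (h.theta_pos k) (sub_ne_zero.mp (h.step_ne_zero k))
        (sum_smul_grad_ne_zero (h.not_critical k) (h.mu_mem k)) j
    · calc ‖correctedDiff F (ϑ k) (μ k) (x k) (x (k + 1)) j
            - act (hess F j z) (x (k + 1) - x k)‖
          = ‖(gradDiff F (x k) (x (k + 1)) j - act (hess F j z) (x (k + 1) - x k))
            + R k • (x (k + 1) - x k)‖ := by
            rw [correctedDiff]; congr 1; abel
        _ ≤ _ := norm_add_le _ _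
        _ ≤ M * (‖x k - z‖ ^ ν + ‖x (k + 1) - z‖ ^ ν) * ‖x (k + 1) - x k‖
            + R k * ‖x (k + 1) - x k‖ := by
            rw [norm_smul, Real.norm_of_nonneg (hR0 k)]
            exact add_le_add (hdiff _ h2 _ h3) le_rfl
        _ = δ k * ‖x (k + 1) - x k‖ := by rw [hδ]; ring
  · intro hsum
    have h1 := hsum ν hν
    have h2 := (summable_nat_add_iff 1).mpr h1
    exact (((h1.add h2).mul_left M).add hr).mul_left C

/-- The iterates converge R-linearly, so that any positive power of their distances to the limit is
summable. The convex
combination of the objectives that is stationary at the limit `z` measures the squared distance to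
`z`; it contracts in every step in which no potential loses more than `1`. -/
lemma summable_norm_sub_rpow [Nonempty (Fin m)] (h : IsRun F ρ σ ϑlo ϑhi x d α ϑ μ B)
    (hF : ContDiff ℝ 2 F) (hx : Tendsto x atTop (𝓝 z)) (hopt : IsLocalParetoOptimal F z)
    (hpos : ∀ j, (hess F j z).PosDef) (hh : ∀ j, HessHolderAt F j z) {e : Fin m → ℕ → ℝ}
    (het : ∀ j, Tendsto (e j) atTop (𝓝 0))
    (hstep : ∀ j, ∀ᶠ k in atTop, potential (hess F j z) (B (k + 1) j) ≤
      potential (hess F j z) (B k j)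
        - potentialLoss (hess F j z) (B k j) (x (k + 1) - x k).ofLp + e j k)
    {ν : ℝ} (hν : 0 < ν) : Summable fun k ↦ ‖x k - z‖ ^ ν := by
  obtain ⟨ε, hloc, hε : 0 < ε⟩ :=
    ((eventually_all.mpr fun j ↦ eventually_localBounds hF (hpos j) (hh j)).and
      self_mem_nhdsWithin).exists
  have hz := Metric.mem_ball_self (x := z) hε
  obtain ⟨w, hw, hw0⟩ := exists_multipliers_of_isLocalParetoOptimal hε hloc hopt
  choose a ha b hb hab using fun j ↦ exists_bounds_of_potentialLoss_le_one (hpos j)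
  -- constants that serve all objectives at once
  obtain ⟨a₀, ha₀, haj⟩ : ∃ a₀ > 0, ∀ j, a₀ ≤ a j := by
    obtain ⟨i, hi⟩ := Finite.exists_min a
    exact ⟨a i, ha i, hi⟩
  obtain ⟨b₀, hb₀, hbj⟩ : ∃ b₀ > 0, ∀ j, b j ≤ b₀ := by
    obtain ⟨i, hi⟩ := Finite.exists_max b
    exact ⟨b i, hb i, hi⟩
  have hesum : Tendsto (fun k ↦ ∑ j, e j k) atTop (𝓝 0) := by
    simpa using tendsto_finsetSum Finset.univ fun j _ ↦ het j
  obtain ⟨N, hN⟩ := eventually_atTop.mp ((eventually_all.mpr hstep).and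
    ((hx.eventually (Metric.ball_mem_nhds z hε)).and
      (hesum.eventually_le_const (show (0 : ℝ) < 1 / 2 by norm_num))))
  set t := fun (j : Fin m) (k : ℕ) ↦
    potentialLoss (hess F j z) (B k j) (x (k + 1) - x k).ofLp with ht
  have ht0 : ∀ j k, 0 ≤ t j k := fun j k ↦
    potentialLoss_nonneg (hpos j) (h.posDef k j)
      ((WithLp.ofLp_eq_zero 2).not.mpr (h.step_ne_zero k))
  set Φ := fun k ↦ ∑ j, w j * (F (x k) j - F z j) with hΦ
  have hΦ0 : ∀ k, 0 ≤ Φ k := fun k ↦ Finset.sum_nonneg fun j _ ↦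
    mul_nonneg (hw.1 j) (sub_nonneg.mpr (h.limit_le hF hx j k))
  have hinner : ∀ v, ∑ j, w j * inner ℝ (grad F j z) v = 0 := fun v ↦ by
    have := congrArg (fun u ↦ inner ℝ u v) hw0
    simpa [sum_inner, real_inner_smul_left] using this
  have hΦup : ∀ k ≥ N, Φ k ≤ 1 / ε * ‖x k - z‖ ^ 2 := by
    intro k hk
    calc Φ k ≤ ∑ j, w j * (inner ℝ (grad F j z) (x k - z) + 1 / ε * ‖x k - z‖ ^ 2) := by
          refine Finset.sum_le_sum fun j _ ↦ mul_le_mul_of_nonneg_left ?_ (hw.1 j)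
          have := (hloc j _ (hN k hk).2.1 z hz).2.2
          linarith
      _ = _ := by
          simp_rw [mul_add]
          rw [Finset.sum_add_distrib, hinner, ← Finset.sum_mul, hw.2]
          ring
  have hΦlow : ∀ k ≥ N, ε * ‖x k - z‖ ^ 2 ≤ Φ k := by
    intro k hk
    calc ε * ‖x k - z‖ ^ 2
        = ∑ j, w j * (inner ℝ (grad F j z) (x k - z) + ε * ‖x k - z‖ ^ 2) := by
          simp_rw [mul_add]
          rw [Finset.sum_add_distrib, hinner, ← Finset.sum_mul, hw.2]
          ring
      _ ≤ Φ k := by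
          refine Finset.sum_le_sum fun j _ ↦ mul_le_mul_of_nonneg_left ?_ (hw.1 j)
          have := (hloc j z hz _ (hN k hk).2.1).2.1
          linarith
  set c := ρ * ((1 - σ) * (a₀ / 2) ^ 2 * ε) * (ε / b₀) ^ 2 with hc
  have hc0 : 0 < c := by
    have h1 : 0 < 1 - σ := sub_pos.mpr h.sigma_mem.2
    have h2 := h.rho_mem.1
    positivity
  -- the contraction factor is kept away from `0`
  set c' := min (c * ε) (1 / 2) with hc'
  have hc'0 : 0 < c' := lt_min (mul_pos hc0 hε) (by norm_num)
  have hgood : ∀ k ≥ N, ∑ j, t j k ≤ 1 → Φ (k + 1) ≤ (1 - c') * Φ k := by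
    intro k hk hT
    have htj : ∀ j, t j k ≤ 1 := fun j ↦
      (Finset.single_le_sum (f := fun j ↦ t j k) (fun i _ ↦ ht0 i k) (Finset.mem_univ j)).trans hT
    have hαk := h.step_pos k
    have hbd : ∀ j, a₀ * ‖d k‖ ^ 2 ≤ inner ℝ (d k) (act (B k j) (d k)) ∧
        ‖act (B k j) (d k)‖ ≤ b₀ * ‖d k‖ := by
      intro j
      have h1 := hab j (B k j) _ (h.posDef k j) (h.step_ne_zero k) (htj j)
      rw [h.step_eq, act_smul, real_inner_smul_left, real_inner_smul_right, norm_smul, norm_smul,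
        Real.norm_of_nonneg hαk.le] at h1
      constructor
      · have h2 : a j * ‖d k‖ ^ 2 ≤ inner ℝ (d k) (act (B k j) (d k)) :=
          le_of_mul_le_mul_left (by linarith [h1.1]) (pow_pos hαk 2)
        exact (mul_le_mul_of_nonneg_right (haj j) (sq_nonneg _)).trans h2
      · have h2 : ‖act (B k j) (d k)‖ ≤ b j * ‖d k‖ :=
          le_of_mul_le_mul_left (by linarith [h1.2]) hαk
        exact h2.trans (mul_le_mul_of_nonneg_right (hbj j) (norm_nonneg _))
    have hdec : ∀ j, F (x (k + 1)) j ≤ F (x k) j - c * ‖x k - z‖ ^ 2 := by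
      intro j
      have hball := (hN (k + 1) (by omega)).2.1
      rw [h.next_iterate] at hball ⊢
      exact wolfe_step_decrease h.rho_mem.1 h.sigma_mem.2 hαk hε ha₀ hb₀ hloc (hN k hk).2.1 hball
        (fun j ↦ (h.posDef k j).isHermitian) (h.direction k) (h.direction_ne_zero k) (h.wolfe k)
        (fun j ↦ h.limit_le hF hx j k) (fun j ↦ (hbd j).1) (fun j ↦ (hbd j).2) j
    have h1 : Φ (k + 1) ≤ Φ k - c * ‖x k - z‖ ^ 2 := by
      calc Φ (k + 1) ≤ ∑ j, w j * ((F (x k) j - F z j) - c * ‖x k - z‖ ^ 2) := by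
            refine Finset.sum_le_sum fun j _ ↦ mul_le_mul_of_nonneg_left ?_ (hw.1 j)
            linarith [hdec j]
        _ = _ := by
            simp_rw [mul_sub _ (F (x k) _ - F z _)]
            rw [Finset.sum_sub_distrib, ← Finset.sum_mul, hw.2, one_mul]
    have h2 : ε * Φ k ≤ ‖x k - z‖ ^ 2 := by
      have := mul_le_mul_of_nonneg_left (hΦup k hk) hε.le
      rwa [← mul_assoc, mul_one_div_cancel hε.ne', one_mul] at this
    have h3 := mul_le_mul_of_nonneg_left h2 hc0.le
    have h4 := mul_le_mul_of_nonneg_right (min_le_left (c * ε) (1 / 2)) (hΦ0 k)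
    linarith
  obtain ⟨A, hA, q, hq0, hq1, hgeo⟩ := exists_geometric_bound
    (Φ := fun k ↦ Φ (k + N)) (Ψ := fun k ↦ ∑ j, potential (hess F j z) (B (k + N) j))
    (T := fun k ↦ ∑ j, t j (k + N)) (e := fun k ↦ ∑ j, e j (k + N)) (c := c')
    (C := ∑ j, Real.log (hess F j z).det) hc'0
    ((min_le_right _ _).trans_lt (by norm_num)) (fun k ↦ hΦ0 _)
    (fun k ↦ Finset.sum_nonneg fun j _ ↦ ht0 j _)
    (fun k ↦ by
      refine Finset.sum_le_sum fun j _ ↦ mul_le_mul_of_nonneg_left ?_ (hw.1 j)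
      exact sub_le_sub_right (h.antitone j (by omega)) _)
    (fun k hk ↦ by
      have := hgood (k + N) (by omega) hk
      rwa [show k + 1 + N = k + N + 1 by omega])
    (fun k ↦ by
      rw [← Finset.sum_sub_distrib, ← Finset.sum_add_distrib,
        show k + 1 + N = k + N + 1 by omega]
      exact Finset.sum_le_sum fun j _ ↦ (hN (k + N) (by omega)).1 j)
    (fun k ↦ (hN (k + N) (by omega)).2.2)
    (fun k ↦ by
      rw [← Finset.sum_neg_distrib]
      exact Finset.sum_le_sum fun j _ ↦ potential_lower_bound (hpos j) (h.posDef _ j))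
  refine (summable_nat_add_iff N).mp ?_
  refine summable_rpow_of_sq_le_geometric (A := A / ε) (fun k ↦ norm_nonneg _) (by positivity)
    hq0 hq1 hν fun k ↦ ?_
  rw [div_mul_eq_mul_div, le_div_iff₀ hε, mul_comm]
  exact (hΦlow (k + N) (by omega)).trans (hgeo k)

end IsRun

end MOBFGS

theorem mainTheorem2 {n m : ℕ} (F : MOBFGS.Vec n → MOBFGS.Vec m) (ρ σ ϑlo ϑhi : ℝ)
    (x d : ℕ → MOBFGS.Vec n) (α ϑ : ℕ → ℝ) (μ : ℕ → Fin m → ℝ)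
    (B : ℕ → Fin m → Matrix (Fin n) (Fin n) ℝ) (xstar : MOBFGS.Vec n)
    (hrun : MOBFGS.IsRun F ρ σ ϑlo ϑhi x d α ϑ μ B)
    (hF : ContDiff ℝ 2 F)
    (hx : Tendsto x atTop (𝓝 xstar))
    (hopt : MOBFGS.IsLocalParetoOptimal F xstar)
    (hpos : ∀ j, (MOBFGS.hess F j xstar).PosDef)
    (hholder : ∀ j, MOBFGS.HessHolderAt F j xstar)
    (hr : ∀ j, Summable fun k => MOBFGS.correction F (ϑ k) (μ k) (x k) (x (k + 1)) j) :
    ∀ j, Tendsto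
      (fun k => ‖MOBFGS.act (B k j - MOBFGS.hess F j xstar) (d k)‖ / ‖d k‖) atTop (𝓝 0) := by
  intro j
  have : Nonempty (Fin m) := ⟨j⟩
  choose e he0 het hstep hsum using fun j ↦
    hrun.exists_potential_error hF hx (hpos j) (hholder j) (hr j)
  have hes : Summable (e j) := hsum j fun ν hν ↦
    hrun.summable_norm_sub_rpow hF hx hopt hpos hholder het hstep hν
  obtain ⟨N, hN⟩ := eventually_atTop.mp (hstep j)
  have hloss : Tendsto (fun k ↦ MOBFGS.potentialLoss (MOBFGS.hess F j xstar) (B k j)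
      (x (k + 1) - x k).ofLp) atTop (𝓝 0) := by
    refine (tendsto_add_atTop_iff_nat N).mp ?_
    refine MOBFGS.tendsto_zero_of_potential
      (Ψ := fun k ↦ MOBFGS.potential (MOBFGS.hess F j xstar) (B (k + N) j))
      (e := fun k ↦ e j (k + N)) (C := Real.log (MOBFGS.hess F j xstar).det)
      (fun k ↦ MOBFGS.potentialLoss_nonneg (hpos j) (hrun.posDef _ j)
        ((WithLp.ofLp_eq_zero 2).not.mpr (hrun.step_ne_zero _)))
      (fun k ↦ he0 j _) ((summable_nat_add_iff N).mpr hes) (fun k ↦ ?_)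
      (fun k ↦ MOBFGS.potential_lower_bound (hpos j) (hrun.posDef _ j))
    have := hN (k + N) (by omega)
    rwa [show k + 1 + N = k + N + 1 by omega]
  -- the quotient is the same for the direction `d k` and the step `x (k + 1) - x k = α k • d k`
  refine (MOBFGS.tendsto_of_potentialLoss_tendsto_zero (hpos j) (fun k ↦ hrun.posDef k j)
    (fun k ↦ hrun.step_ne_zero k) hloss).congr fun k ↦ ?_
  rw [hrun.step_eq, MOBFGS.act_smul, norm_smul, norm_smul,
    mul_div_mul_left _ _ (norm_ne_zero_iff.mpr (hrun.step_pos k).ne')]
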